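/- Let $d\ge 2$ and $n\ge 0$ be integers. For a vector $\ell=(l_1,\dots,l_n)$ of positive real numbers put $$E_d(\ell)=\Big\{(u_1,\dots,u_n)\in (S^{d-1})^n : \sum_{k=1}^n l_k u_k=0\Big\}\subset(\mathbb R^d)^n,$$ with the diagonal action of the orthogonal group $\mathrm O(d)$. Call $\ell$ generic if there is no subset $J\subset\{1,\dots,n\}$ with $\sum_{j\in J}l_j=\sum_{j\notin J}l_j$. Two generic vectors $\ell,\ell'$ lie in the same chamber if for every $J\subset\{1,\dots,n\}$ one has $\sum_{j\in J}l_j>\sum_{j\notin J}l_j$ if and only if $\sum_{j\in J}l'_j>\sum_{j\notin J}l'_j$. Let $\ell,\ell'$ be generic vectors of $n$ positive real numbers that lie in the same chamber. Then $E_d(\ell)$ and $E_d(\ell')$ are (possibly empty) smooth embedded submanifolds of $(\mathbb R^d)^n$ of dimension $(n-1)(d-1)-1$, and they are $\mathrm O(d)$-equivariantly diffeomorphic: there is a $C^\infty$ diffeomorphism $\Phi:E_d(\ell)\to E_d(\ell')$ with $\Phi(gu)=g\,\Phi(u)$ for all $g\in \mathrm O(d)$ and $u\in E_d(\ell)$.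 (For $n\le 2$ both spaces are empty, and the assertion about the dimension is void.) -/

import Mathlib

open scoped Manifold ContDiff

noncomputable section

/-- The space `E_d(ℓ)` of closed `n`-gons in `ℝ^d` with side lengths `ℓ`, up to translation:
tuples of unit vectors `u` with `∑ ℓ k • u k = 0`. It carries the subspace topology. -/
def polygonSpace (d : ℕ) {n : ℕ} (ℓ : Fin n → ℝ) : Set (Fin n → EuclideanSpace ℝ (Fin d)) :=
  {u | (∀ k, u k ∈ Metric.sphere (0 : EuclideanSpace ℝ (Fin d)) 1) ∧ ∑ k, ℓ k • u k = 0}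

/-- A length vector is generic if no set of indices has the same total length as its
complement. -/
def IsGenericLength {n : ℕ} (ℓ : Fin n → ℝ) : Prop :=
  ¬ ∃ J : Finset (Fin n), ∑ j ∈ J, ℓ j = ∑ j ∈ Jᶜ, ℓ j

/-- Two length vectors lie in the same chamber if they have the same long sets of indices. -/
def SameChamber {n : ℕ} (ℓ ℓ' : Fin n → ℝ) : Prop :=
  ∀ J : Finset (Fin n), ∑ j ∈ J, ℓ j > ∑ j ∈ Jᶜ, ℓ j ↔ ∑ j ∈ J, ℓ' j > ∑ j ∈ Jᶜ, ℓ' j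

/-- An orthogonal matrix acts on `ℝ^d` by a norm preserving map. -/
theorem norm_toEuclideanLin_orthogonal {d : ℕ} (g : Matrix.orthogonalGroup (Fin d) ℝ)
    (x : EuclideanSpace ℝ (Fin d)) : ‖Matrix.toEuclideanLin g.1 x‖ = ‖x‖ := by
  have h : g.1.transpose * g.1 = 1 := (Matrix.mem_orthogonalGroup_iff' (Fin d) ℝ).1 g.2
  have h2 : ‖Matrix.toEuclideanLin g.1 x‖ ^ 2 = ‖x‖ ^ 2 := by
    rw [← real_inner_self_eq_norm_sq, ← real_inner_self_eq_norm_sq]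
    simp only [EuclideanSpace.inner_eq_star_dotProduct, star_trivial, Matrix.ofLp_toLpLin,
      Matrix.toLin'_apply]
    rw [Matrix.dotProduct_mulVec, Matrix.vecMul_mulVec, h, Matrix.vecMul_one]
  exact (pow_left_inj₀ (norm_nonneg _) (norm_nonneg _) two_ne_zero).1 h2

/-- The diagonal action of the orthogonal group `O(d)` on the space of polygons. -/
instance polygonSpace.mulAction (d : ℕ) {n : ℕ} (ℓ : Fin n → ℝ) :
    MulAction (Matrix.orthogonalGroup (Fin d) ℝ) (polygonSpace d ℓ) where
  smul g u := ⟨fun k => Matrix.toEuclideanLin g.1 (u.1 k), by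
    refine ⟨fun k => ?_, ?_⟩
    · have := u.2.1 k
      rw [mem_sphere_zero_iff_norm] at this ⊢
      rw [norm_toEuclideanLin_orthogonal, this]
    · have := congrArg (Matrix.toEuclideanLin g.1) u.2.2
      simpa only [map_sum, map_smul, map_zero] using this⟩
  one_smul u := by
    apply Subtype.ext
    funext k
    change Matrix.toEuclideanLin (1 : Matrix (Fin d) (Fin d) ℝ) (u.1 k) = u.1 k
    simp
  mul_smul g h u := by
    apply Subtype.ext
    funext k
    change Matrix.toEuclideanLin (g.1 * h.1) (u.1 k) =
      Matrix.toEuclideanLin g.1 (Matrix.toEuclideanLin h.1 (u.1 k))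
    simp

/-- A charted space structure (modelled on `ℝ^m`) on a subset `S` of a normed space, compatible
with the subspace topology, is the structure of a smooth embedded submanifold if it is a smooth
manifold structure for which the inclusion is a smooth embedding. -/
structure IsEmbeddedSubmanifold (m : ℕ) {V : Type*} [NormedAddCommGroup V] [NormedSpace ℝ V]
    (S : Set V) [ChartedSpace (EuclideanSpace ℝ (Fin m)) S] : Prop where
  isManifold : IsManifold (𝓡 m) ∞ S
  isSmoothEmbedding : Manifold.IsSmoothEmbedding (𝓡 m) 𝓘(ℝ, V) ∞ (Subtype.val : S → V)

/-- The dimension of the space of polygons (the value is irrelevant when `n ≤ 2`, as then the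
space is empty for generic positive `ℓ`). -/
def polygonDim (d n : ℕ) : ℕ := (n - 1) * (d - 1) - 1

end

/-!
Unit vectors of `ℝ^d` are the points of the sphere at infinity of hyperbolic space, in the
hyperboloid model of `ℝ × ℝ^d`, and a configuration of them closes up to a polygon with side
lengths `ℓ` exactly when its conformal barycenter with weights `ℓ` is the origin `(1, 0)`. The
barycenter minimizes the weighted sum of Busemann functions, so it exists as soon as no point
carries half of the total weight or more; a closed polygon with lengths `ℓ` has this property for
the weights `ℓ'` when `ℓ'` is generic and lies in the chamber of `ℓ`.

The half-turn of hyperbolic space exchanging the `ℓ'`-barycenter with the origin therefore carries a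
closed `ℓ`-polygon to a closed `ℓ'`-polygon. As it also exchanges the `ℓ`-barycenter, the origin,
with the `ℓ'`-barycenter, applying the same construction with `ℓ` undoes it.

For generic weights the barycenter is unique and the equation defining it is nondegenerate, since
equality in the Cauchy–Schwarz inequality would force a signed sum of the weights to vanish. By the
implicit function theorem the barycenter depends smoothly on the configuration; at the origin, the
same nondegeneracy makes the polygon equations regular.
-/

section SliceCharts

variable {V F W : Type*} [NormedAddCommGroup V] [NormedSpace ℝ V] [NormedAddCommGroup F]
  [NormedSpace ℝ F] [NormedAddCommGroup W] [NormedSpace ℝ W] {S : Set V}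

/-- A smooth ambient chart straightening `S`: in it, `S` is the slice where the second coordinate
vanishes. -/
structure IsSliceChart (S : Set V) (e : OpenPartialHomeomorph V (F × W)) : Prop where
  contDiffOn : ContDiffOn ℝ ∞ e e.source
  contDiffOn_symm : ContDiffOn ℝ ∞ e.symm e.target
  mem_iff : ∀ x ∈ e.source, x ∈ S ↔ (e x).2 = 0

namespace IsSliceChart

variable {e : OpenPartialHomeomorph V (F × W)}

theorem mk_fst_zero (h : IsSliceChart S e) (x : S) (hx : x.1 ∈ e.source) :
    ((e x).1, (0 : W)) = e x :=
  Prod.ext rfl ((h.mem_iff x hx).1 x.2).symm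

theorem symm_mem (h : IsSliceChart S e) {y : F} (hy : (y, (0 : W)) ∈ e.target) :
    e.symm (y, 0) ∈ S :=
  (h.mem_iff _ (e.map_target hy)).2 (by rw [e.right_inv hy])

open Classical in
/-- The chart of `S` given by the first coordinate of a slice chart. The point `p` is the value of
the inverse outside the target. -/
noncomputable def chart (h : IsSliceChart S e) (p : S) : OpenPartialHomeomorph S F where
  toFun x := (e x).1
  invFun y := if hy : e.symm (y, 0) ∈ S then ⟨e.symm (y, 0), hy⟩ else p
  source := Subtype.val ⁻¹' e.source
  target := (·, (0 : W)) ⁻¹' e.target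
  map_source' x hx := by
    rw [Set.mem_preimage, h.mk_fst_zero x hx]
    exact e.map_source hx
  map_target' y hy := by
    rw [dif_pos (h.symm_mem hy)]
    exact e.map_target hy
  left_inv' x hx := by
    have hsymm : e.symm ((e x).1, 0) = x := by rw [h.mk_fst_zero x hx, e.left_inv hx]
    rw [dif_pos (by rw [hsymm]; exact x.2)]
    exact Subtype.ext hsymm
  right_inv' y hy := by
    rw [dif_pos (h.symm_mem hy)]
    change (e (e.symm (y, 0))).1 = y
    rw [e.right_inv hy]
  open_source := e.open_source.preimage continuous_subtype_val
  open_target := e.open_target.preimage (by fun_prop)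
  continuousOn_toFun :=
    continuous_fst.comp_continuousOn
      (e.continuousOn.comp continuous_subtype_val.continuousOn fun _ hx => hx)
  continuousOn_invFun := by
    refine Topology.IsInducing.subtypeVal.continuousOn_iff.2 ?_
    refine (e.continuousOn_symm.comp (f := (·, (0 : W))) (by fun_prop) fun _ hy => hy).congr
      fun y hy => ?_
    simp only [Function.comp_apply]
    rw [dif_pos (h.symm_mem hy)]

theorem chart_apply (h : IsSliceChart S e) (p x : S) : h.chart p x = (e x).1 := rfl

theorem mem_chart_source (h : IsSliceChart S e) {p x : S} :
    x ∈ (h.chart p).source ↔ x.1 ∈ e.source := Iff.rfl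

theorem mem_chart_target (h : IsSliceChart S e) {p : S} {y : F} :
    y ∈ (h.chart p).target ↔ (y, (0 : W)) ∈ e.target := Iff.rfl

theorem coe_chart_symm_apply (h : IsSliceChart S e) {p : S} {y : F}
    (hy : y ∈ (h.chart p).target) : ((h.chart p).symm y : V) = e.symm (y, 0) :=
  congrArg Subtype.val (dif_pos (h.symm_mem hy))

theorem contDiffOn_chart_symm_trans {e' : OpenPartialHomeomorph V (F × W)}
    (h : IsSliceChart S e) (h' : IsSliceChart S e') (p p' : S) :
    ContDiffOn ℝ ∞ ((h.chart p).symm.trans (h'.chart p'))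
      ((h.chart p).symm.trans (h'.chart p')).source := by
  have hsource : ∀ y ∈ ((h.chart p).symm.trans (h'.chart p')).source,
      y ∈ (h.chart p).target ∧ e.symm (y, 0) ∈ e'.source := fun y hy => by
    rw [OpenPartialHomeomorph.trans_source] at hy
    exact ⟨hy.1, h.coe_chart_symm_apply hy.1 ▸ (h'.mem_chart_source (p := p')).1 hy.2⟩
  have hsmooth : ContDiffOn ℝ ∞ (fun y => (e' (e.symm (y, 0))).1)
      ((h.chart p).symm.trans (h'.chart p')).source :=
    contDiff_fst.comp_contDiffOn <| h'.contDiffOn.comp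
      (h.contDiffOn_symm.comp (contDiff_id.prodMk contDiff_const).contDiffOn
        fun y hy => (hsource y hy).1) fun y hy => (hsource y hy).2
  refine hsmooth.congr fun y hy => ?_
  rw [OpenPartialHomeomorph.coe_trans, Function.comp_apply, chart_apply,
    h.coe_chart_symm_apply (hsource y hy).1]

theorem trans_mem_maximalAtlas (h : IsSliceChart S e) (L : (F × W) ≃L[ℝ] V) :
    e.trans L.toHomeomorph.toOpenPartialHomeomorph ∈ IsManifold.maximalAtlas 𝓘(ℝ, V) ∞ V := by
  refine StructureGroupoid.mem_maximalAtlas_of_mem_groupoid _ ?_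
  rw [contDiffGroupoid, mem_groupoid_of_pregroupoid]
  constructor
  · simpa [contDiffPregroupoid] using L.contDiff.comp_contDiffOn h.contDiffOn
  · simpa [contDiffPregroupoid] using
      h.contDiffOn_symm.comp L.symm.contDiff.contDiffOn fun x hx => by simpa using hx

end IsSliceChart

/-- The charted space structure on `S` given by a family of slice charts covering it. -/
noncomputable abbrev sliceChartedSpace (e : S → OpenPartialHomeomorph V (F × W))
    (he : ∀ p, IsSliceChart S (e p)) (hmem : ∀ p : S, p.1 ∈ (e p).source) : ChartedSpace F S where
  atlas := Set.range fun p => (he p).chart p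
  chartAt p := (he p).chart p
  mem_chart_source := hmem
  chart_mem_atlas := Set.mem_range_self

variable {e : S → OpenPartialHomeomorph V (F × W)}

theorem isManifold_sliceChartedSpace (he : ∀ p, IsSliceChart S (e p))
    (hmem : ∀ p : S, p.1 ∈ (e p).source) :
    letI := sliceChartedSpace e he hmem
    IsManifold 𝓘(ℝ, F) ∞ S := by
  let := sliceChartedSpace e he hmem
  refine isManifold_of_contDiffOn 𝓘(ℝ, F) ∞ S ?_
  rintro _ _ ⟨p, rfl⟩ ⟨q, rfl⟩
  simpa only [modelWithCornersSelf_coe, modelWithCornersSelf_coe_symm, Function.id_comp,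
    Function.comp_id, Set.preimage_id, Set.range_id, Set.inter_univ] using
    (he p).contDiffOn_chart_symm_trans (he q) p q

theorem isImmersion_val_sliceChartedSpace (he : ∀ p, IsSliceChart S (e p))
    (hmem : ∀ p : S, p.1 ∈ (e p).source) (L : (F × W) ≃L[ℝ] V) :
    letI := sliceChartedSpace e he hmem
    Manifold.IsImmersion 𝓘(ℝ, F) 𝓘(ℝ, V) ∞ (Subtype.val : S → V) := by
  let := sliceChartedSpace e he hmem
  have := isManifold_sliceChartedSpace he hmem
  refine Manifold.IsImmersionOfComplement.isImmersion (F := W) fun p => ?_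
  refine Manifold.IsImmersionAtOfComplement.mk_of_charts L ((he p).chart p)
    ((e p).trans L.toHomeomorph.toOpenPartialHomeomorph) (hmem p) (by simpa using hmem p)
    (IsManifold.chart_mem_maximalAtlas p) ((he p).trans_mem_maximalAtlas L)
    (fun x hx => by simpa using (he p).mem_chart_source.1 hx) fun y hy => ?_
  have hy' : y ∈ ((he p).chart p).target := by simpa using hy
  simp [(he p).coe_chart_symm_apply hy',
    (e p).right_inv ((he p).mem_chart_target.1 hy')]

theorem exists_isEmbeddedSubmanifold_of_isSliceChart {m : ℕ}
    (L : (EuclideanSpace ℝ (Fin m) × W) ≃L[ℝ] V)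
    (hS : ∀ p ∈ S, ∃ e : OpenPartialHomeomorph V (EuclideanSpace ℝ (Fin m) × W),
      p ∈ e.source ∧ IsSliceChart S e) :
    ∃ _ : ChartedSpace (EuclideanSpace ℝ (Fin m)) S, IsEmbeddedSubmanifold m S := by
  choose e hmem he using fun p : S => hS p p.2
  let := sliceChartedSpace e he hmem
  exact ⟨this, isManifold_sliceChartedSpace he hmem,
    isImmersion_val_sliceChartedSpace he hmem L, Topology.IsEmbedding.subtypeVal⟩

end SliceCharts

section RegularValues

open Module

variable {V F W : Type*} [NormedAddCommGroup V] [NormedSpace ℝ V] [NormedAddCommGroup F]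
  [NormedSpace ℝ F] [NormedAddCommGroup W] [NormedSpace ℝ W]

theorem exists_openPartialHomeomorph_of_contDiff [CompleteSpace V] {G : V → W}
    (hG : ContDiff ℝ ∞ G) {A : V ≃L[ℝ] W} {p : V} (hA : HasFDerivAt G (A : V →L[ℝ] W) p) :
    ∃ e : OpenPartialHomeomorph V W, p ∈ e.source ∧ ⇑e = G ∧ ContDiffOn ℝ ∞ e.symm e.target := by
  let e := hG.contDiffAt.toOpenPartialHomeomorph G hA (by simp)
  let U : Set V := fderiv ℝ G ⁻¹' Set.range ((↑) : (V ≃L[ℝ] W) → V →L[ℝ] W)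
  have hU : IsOpen U := ContinuousLinearEquiv.isOpen.preimage (hG.continuous_fderiv (by simp))
  have hpe : p ∈ e.source := hG.contDiffAt.mem_toOpenPartialHomeomorph_source hA (by simp)
  refine ⟨e.restrOpen U hU, ⟨hpe, A, hA.fderiv.symm⟩, rfl, fun y hy => ?_⟩
  obtain ⟨B, hB⟩ := ((e.restrOpen U hU).map_target hy).2
  refine ((e.restrOpen U hU).contDiffAt_symm hy (f₀' := B) ?_ hG.contDiffAt).contDiffWithinAt
  rw [hB]
  exact (hG.differentiable (by simp) _).hasFDerivAt

theorem exists_continuousLinearEquiv_prod_of_surjective [FiniteDimensional ℝ V]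
    [FiniteDimensional ℝ F] [FiniteDimensional ℝ W] {f : V →L[ℝ] W} (hf : Function.Surjective f)
    (hdim : finrank ℝ V = finrank ℝ F + finrank ℝ W) :
    ∃ (T : V →L[ℝ] F) (A : V ≃L[ℝ] F × W), (A : V →L[ℝ] F × W) = T.prod f := by
  let K := LinearMap.ker (f : V →ₗ[ℝ] W)
  have hfrange : LinearMap.range (f : V →ₗ[ℝ] W) = ⊤ := LinearMap.range_eq_top.2 hf
  have hK : finrank ℝ K = finrank ℝ F := by
    have hrank := LinearMap.finrank_range_add_finrank_ker (f : V →ₗ[ℝ] W)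
    rw [hfrange, finrank_top] at hrank
    exact Nat.add_left_cancel (hrank.trans (hdim.trans (Nat.add_comm _ _)))
  obtain ⟨π, hπ⟩ := LinearMap.exists_leftInverse_of_injective K.subtype K.ker_subtype
  have hπK : ∀ x : K, π x = x := LinearMap.congr_fun hπ
  let T : V →ₗ[ℝ] F := (LinearEquiv.ofFinrankEq _ _ hK).toLinearMap ∘ₗ π
  have hTrange : LinearMap.range T = ⊤ := LinearMap.range_eq_top.2 <|
    (LinearEquiv.surjective _).comp (LinearMap.range_eq_top.1 (LinearMap.range_eq_of_proj hπK))
  have hTker : LinearMap.ker T = LinearMap.ker π := LinearEquiv.ker_comp _ _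
  have hcompl : IsCompl (LinearMap.ker T) K := hTker ▸ (LinearMap.isCompl_of_proj hπK).symm
  exact ⟨T.toContinuousLinearMap, (T.equivProdOfSurjectiveOfIsCompl (f : V →ₗ[ℝ] W) hTrange
    hfrange hcompl).toContinuousLinearEquiv, rfl⟩

theorem exists_isSliceChart_of_surjective_fderiv [FiniteDimensional ℝ V] [FiniteDimensional ℝ F]
    [FiniteDimensional ℝ W] {f : V → W} (hf : ContDiff ℝ ∞ f) {p : V}
    (hsurj : Function.Surjective (fderiv ℝ f p))
    (hdim : finrank ℝ V = finrank ℝ F + finrank ℝ W) :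
    ∃ e : OpenPartialHomeomorph V (F × W), p ∈ e.source ∧ IsSliceChart (f ⁻¹' {0}) e := by
  have := FiniteDimensional.complete ℝ V
  obtain ⟨T, A, hA⟩ := exists_continuousLinearEquiv_prod_of_surjective hsurj hdim
  have hG : ContDiff ℝ ∞ fun x => (T x, f x) := T.contDiff.prodMk hf
  have hGp : HasFDerivAt (fun x => (T x, f x)) (A : V →L[ℝ] F × W) p :=
    hA ▸ T.hasFDerivAt.prodMk (hf.differentiable (by simp) p).hasFDerivAt
  obtain ⟨e, hp, he, hsymm⟩ := exists_openPartialHomeomorph_of_contDiff hG hGp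
  exact ⟨e, hp, he ▸ hG.contDiffOn, hsymm, fun x _ => by rw [he]; rfl⟩

theorem exists_isEmbeddedSubmanifold_preimage_zero [FiniteDimensional ℝ V]
    [FiniteDimensional ℝ W] {m : ℕ} {f : V → W} (hf : ContDiff ℝ ∞ f)
    (hsurj : ∀ p, f p = 0 → Function.Surjective (fderiv ℝ f p))
    (hdim : finrank ℝ V = m + finrank ℝ W) :
    ∃ _ : ChartedSpace (EuclideanSpace ℝ (Fin m)) (f ⁻¹' {0}),
      IsEmbeddedSubmanifold m (f ⁻¹' {0}) := by
  rw [← finrank_euclideanSpace_fin (𝕜 := ℝ) (n := m)] at hdim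
  refine exists_isEmbeddedSubmanifold_of_isSliceChart (W := W)
    (LinearEquiv.ofFinrankEq _ _ (by rw [hdim, finrank_prod])).toContinuousLinearEquiv
    fun p hp => exists_isSliceChart_of_surjective_fderiv hf (hsurj p hp) hdim

theorem exists_isEmbeddedSubmanifold_empty (m : ℕ) (V : Type*) [NormedAddCommGroup V]
    [NormedSpace ℝ V] :
    ∃ _ : ChartedSpace (EuclideanSpace ℝ (Fin m)) (∅ : Set V),
      IsEmbeddedSubmanifold m (∅ : Set V) :=
  letI : ChartedSpace (EuclideanSpace ℝ (Fin m)) (∅ : Set V) := ChartedSpace.empty _ _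
  ⟨this, inferInstance, Manifold.IsImmersionOfComplement.isImmersion (F := V) fun p => p.2.elim,
    Topology.IsEmbedding.subtypeVal⟩

theorem IsEmbeddedSubmanifold.contMDiff_of_contDiffOn {m m' : ℕ} {S : Set V} {S' : Set W}
    [ChartedSpace (EuclideanSpace ℝ (Fin m)) S] [ChartedSpace (EuclideanSpace ℝ (Fin m')) S']
    (hS : IsEmbeddedSubmanifold m S) (hS' : IsEmbeddedSubmanifold m' S') {f : V → W}
    (hf : ContDiffOn ℝ ∞ f S) {φ : S → S'} (hφ : ∀ x, (φ x : W) = f x) :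
    ContMDiff (𝓡 m) (𝓡 m') ∞ φ := by
  rw [ContMDiff.iff_comp_isImmersion hS'.isSmoothEmbedding.isImmersion]
  have hcomp : Subtype.val ∘ φ = f ∘ Subtype.val := funext hφ
  constructor
  · rw [Topology.IsInducing.subtypeVal.continuous_iff, hcomp]
    exact hf.continuousOn.comp_continuous continuous_subtype_val fun x => x.2
  · rw [hcomp]
    exact hf.contMDiffOn.comp_contMDiff hS.isSmoothEmbedding.contMDiff fun x => x.2

end RegularValues

section HomogeneousCoordinates

/-- The null vector representing the point `u` of the unit sphere, viewed as the sphere at infinity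
of hyperbolic space. -/
def lightVector {E : Type*} (u : E) : ℝ × E := (1, u)

variable {E : Type*} [AddCommGroup E] [Module ℝ E]

/-- The point of `E` represented by a vector of `ℝ × E` read in homogeneous coordinates; on null
vectors it inverts `lightVector`. -/
noncomputable def direction (v : ℝ × E) : E := v.1⁻¹ • v.2

theorem lightVector_direction {v : ℝ × E} (hv : v.1 ≠ 0) :
    lightVector (direction v) = v.1⁻¹ • v :=
  Prod.ext (inv_mul_cancel₀ hv).symm rfl

theorem direction_lightVector (u : E) : direction (lightVector u) = u := by
  simp [direction, lightVector]

theorem direction_smul {c : ℝ} (hc : c ≠ 0) (v : ℝ × E) : direction (c • v) = direction v := by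
  simp only [direction, Prod.smul_fst, Prod.smul_snd, smul_smul, smul_eq_mul, mul_inv]
  rw [mul_right_comm, inv_mul_cancel₀ hc, one_mul]

end HomogeneousCoordinates

section LorentzForm

open scoped RealInnerProductSpace

variable {E : Type*} [NormedAddCommGroup E] [InnerProductSpace ℝ E]

/-- The Lorentz form `X₁ Y₁ - ⟪X₂, Y₂⟫` on `ℝ × E`. A vector `X` with `‖X.2‖ < X.1` lies in its
open future cone, and those with `lorentzForm X X = 1` are the points of the hyperboloid model of
hyperbolic space. -/
noncomputable def lorentzForm : LinearMap.BilinForm ℝ (ℝ × E) :=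
  (LinearMap.mul ℝ ℝ).compl₁₂ (.fst ℝ ℝ E) (.fst ℝ ℝ E) -
    (innerₗ E).compl₁₂ (.snd ℝ ℝ E) (.snd ℝ ℝ E)

theorem lorentzForm_apply (X Y : ℝ × E) : lorentzForm X Y = X.1 * Y.1 - ⟪X.2, Y.2⟫ := rfl

theorem lorentzForm_comm (X Y : ℝ × E) : lorentzForm X Y = lorentzForm Y X := by
  rw [lorentzForm_apply, lorentzForm_apply, mul_comm, real_inner_comm]

theorem lorentzForm_self (X : ℝ × E) : lorentzForm X X = X.1 ^ 2 - ‖X.2‖ ^ 2 := by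
  rw [lorentzForm_apply, real_inner_self_eq_norm_sq, ← sq]

theorem lorentzForm_one_zero (X : ℝ × E) : lorentzForm X (1, 0) = X.1 := by
  simp [lorentzForm_apply]

theorem lorentzForm_lightVector (X : ℝ × E) (u : E) :
    lorentzForm X (lightVector u) = X.1 - ⟪X.2, u⟫ := by
  simp [lorentzForm_apply, lightVector]

theorem lorentzForm_lightVector_self {u : E} (hu : ‖u‖ = 1) :
    lorentzForm (lightVector u) (lightVector u) = 0 := by
  simp [lorentzForm_self, lightVector, hu]

theorem lorentzForm_lightVector_pos {X : ℝ × E} (hX : ‖X.2‖ < X.1) {u : E} (hu : ‖u‖ = 1) :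
    0 < lorentzForm X (lightVector u) := by
  rw [lorentzForm_lightVector, sub_pos]
  calc ⟪X.2, u⟫ ≤ ‖X.2‖ * ‖u‖ := real_inner_le_norm _ _
    _ < X.1 := by rwa [hu, mul_one]

theorem lorentzForm_pos {X Y : ℝ × E} (hX : ‖X.2‖ < X.1) (hY : ‖Y.2‖ < Y.1) :
    0 < lorentzForm X Y := by
  rw [lorentzForm_apply, sub_pos]
  exact (real_inner_le_norm _ _).trans_lt
    (mul_lt_mul'' hX hY (norm_nonneg _) (norm_nonneg _))

theorem lorentzForm_self_nonpos {u : E} (hu : ‖u‖ = 1) {W : ℝ × E}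
    (hW : lorentzForm W (lightVector u) = 0) : lorentzForm W W ≤ 0 := by
  rw [lorentzForm_lightVector, sub_eq_zero] at hW
  have hle : |W.1| ≤ ‖W.2‖ := by
    simpa only [hW, hu, mul_one] using abs_real_inner_le_norm W.2 u
  rw [lorentzForm_self, sub_nonpos, ← sq_abs]
  gcongr

theorem eq_zero_of_lorentzForm_eq_zero {X Z : ℝ × E} (hX : ‖X.2‖ < X.1)
    (hZX : lorentzForm Z X = 0) (hZ : 0 ≤ lorentzForm Z Z) : Z = 0 := by
  rw [lorentzForm_apply, sub_eq_zero] at hZX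
  rw [lorentzForm_self, sub_nonneg, sq_le_sq, abs_norm] at hZ
  have hle : |Z.1| * X.1 ≤ |Z.1| * ‖X.2‖ :=
    calc |Z.1| * X.1 = |⟪Z.2, X.2⟫| := by
          rw [← hZX, abs_mul, abs_of_pos ((norm_nonneg _).trans_lt hX)]
      _ ≤ ‖Z.2‖ * ‖X.2‖ := abs_real_inner_le_norm _ _
      _ ≤ |Z.1| * ‖X.2‖ := by gcongr
  have hZ1 : |Z.1| = 0 := by nlinarith [abs_nonneg Z.1]
  exact Prod.ext (abs_eq_zero.1 hZ1) (norm_le_zero_iff.1 (hZ.trans hZ1.le))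

theorem sq_lorentzForm_div_sub_le {X Z : ℝ × E} (hX : lorentzForm X X = 1) {u : E}
    (hu : ‖u‖ = 1) (hXu : lorentzForm X (lightVector u) ≠ 0) :
    (lorentzForm Z (lightVector u) / lorentzForm X (lightVector u) - lorentzForm Z X) ^ 2 ≤
      lorentzForm Z X ^ 2 - lorentzForm Z Z := by
  set b := lorentzForm Z (lightVector u) / lorentzForm X (lightVector u) with hb
  have hW : lorentzForm (Z - b • X) (lightVector u) = 0 := by
    simp only [map_sub, map_smul, LinearMap.sub_apply, LinearMap.smul_apply, smul_eq_mul]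
    rw [hb, div_mul_cancel₀ _ hXu, sub_self]
  have hnonpos := lorentzForm_self_nonpos hu hW
  simp only [map_sub, map_smul, LinearMap.sub_apply, LinearMap.smul_apply, smul_eq_mul, hX,
    lorentzForm_comm X Z] at hnonpos
  linarith

theorem eq_lorentzForm_smul_of_sq_le {X Z : ℝ × E} (hX : ‖X.2‖ < X.1)
    (hX1 : lorentzForm X X = 1) (hZ : lorentzForm Z X ^ 2 ≤ lorentzForm Z Z) :
    Z = lorentzForm Z X • X := by
  refine sub_eq_zero.1 (eq_zero_of_lorentzForm_eq_zero hX ?_ ?_) <;>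
    simp only [map_sub, map_smul, LinearMap.sub_apply, LinearMap.smul_apply, smul_eq_mul, hX1,
      lorentzForm_comm X Z]
  · ring
  · linarith

theorem norm_direction {v : ℝ × E} (hv : lorentzForm v v = 0) (hv1 : v.1 ≠ 0) :
    ‖direction v‖ = 1 := by
  rw [lorentzForm_self, sub_eq_zero, sq_eq_sq_iff_abs_eq_abs, abs_norm] at hv
  rw [direction, norm_smul, norm_inv, Real.norm_eq_abs, hv, inv_mul_cancel₀]
  exact hv ▸ abs_ne_zero.2 hv1

end LorentzForm

section LorentzIsometries

variable {E : Type*} [NormedAddCommGroup E] [InnerProductSpace ℝ E]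

/-- A linear map preserving the Lorentz form. -/
def IsLorentzIsometry (T : ℝ × E →ₗ[ℝ] ℝ × E) : Prop :=
  ∀ v w, lorentzForm (T v) (T w) = lorentzForm v w

/-- The Lorentz half-turn about the line spanned by `M` (meaningful when
`lorentzForm M M ≠ 0`); on hyperbolic space it is the point reflection at the multiple of `M`. -/
noncomputable def halfTurn (M : ℝ × E) : Module.End ℝ (ℝ × E) :=
  -Module.preReflection M ((2 / lorentzForm M M) • lorentzForm M)

theorem halfTurn_apply (M v : ℝ × E) :
    halfTurn M v = (2 / lorentzForm M M * lorentzForm M v) • M - v := by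
  simp [halfTurn, Module.preReflection_apply]

theorem halfTurn_halfTurn {M : ℝ × E} (hM : lorentzForm M M ≠ 0) (v : ℝ × E) :
    halfTurn M (halfTurn M v) = v := by
  simpa [halfTurn] using Module.involutive_preReflection (x := M)
    (f := (2 / lorentzForm M M) • lorentzForm M) (by simp [hM]) v

theorem isLorentzIsometry_halfTurn {M : ℝ × E} (hM : lorentzForm M M ≠ 0) :
    IsLorentzIsometry (halfTurn M) := fun v w => by
  simp only [halfTurn_apply, map_sub, map_smul, LinearMap.sub_apply, LinearMap.smul_apply,
    smul_eq_mul, lorentzForm_comm v M]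
  field_simp
  ring

theorem halfTurn_add_apply_right {X Y : ℝ × E} (h : lorentzForm X X = lorentzForm Y Y)
    (hXY : lorentzForm (X + Y) (X + Y) ≠ 0) : halfTurn (X + Y) Y = X := by
  have htwo : 2 * lorentzForm (X + Y) Y = lorentzForm (X + Y) (X + Y) := by
    simp only [map_add, LinearMap.add_apply, h, lorentzForm_comm Y X]
    ring
  rw [halfTurn_apply, div_mul_eq_mul_div, htwo, div_self hXY, one_smul, add_sub_cancel_right]

theorem halfTurn_add_apply_left {X Y : ℝ × E} (h : lorentzForm X X = lorentzForm Y Y)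
    (hXY : lorentzForm (X + Y) (X + Y) ≠ 0) : halfTurn (X + Y) X = Y := by
  rw [add_comm] at hXY ⊢
  exact halfTurn_add_apply_right h.symm hXY

/-- The linear isometry `g` of `E` acting on `ℝ × E`, fixing the time axis. -/
def spatialMap (g : E →ₗᵢ[ℝ] E) : ℝ × E →ₗ[ℝ] ℝ × E := LinearMap.id.prodMap g.toLinearMap

theorem isLorentzIsometry_spatialMap (g : E →ₗᵢ[ℝ] E) : IsLorentzIsometry (spatialMap g) :=
  fun v w => congrArg (v.1 * w.1 - ·) (g.inner_map_map v.2 w.2)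

theorem spatialMap_halfTurn (g : E →ₗᵢ[ℝ] E) (M v : ℝ × E) :
    spatialMap g (halfTurn M v) = halfTurn (spatialMap g M) (spatialMap g v) := by
  simp only [halfTurn_apply, map_sub, map_smul, isLorentzIsometry_spatialMap g _ _]

theorem direction_spatialMap (g : E →ₗᵢ[ℝ] E) (v : ℝ × E) :
    direction (spatialMap g v) = g (direction v) :=
  (g.map_smul v.1⁻¹ v.2).symm

end LorentzIsometries

section GenericLengths

theorem forall_eq_zero_of_sum_mul_eq_zero {ι : Type*} [Fintype ι] {ℓ y : ι → ℝ}
    (hpos : ∀ k, 0 < ℓ k) (hy : ∀ k, 0 ≤ y k) (hsum : ∑ k, ℓ k * y k = 0) (k : ι) : y k = 0 := by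
  have hterm := (Finset.sum_eq_zero_iff_of_nonneg fun i _ => mul_nonneg (hpos i).le (hy i)).1 hsum
  exact (mul_eq_zero.1 (hterm k (Finset.mem_univ k))).resolve_left (hpos k).ne'

variable {n : ℕ} {ℓ : Fin n → ℝ}

theorem IsGenericLength.nonempty (hgen : IsGenericLength ℓ) : Nonempty (Fin n) := by
  by_contra hempty
  have := not_nonempty_iff.1 hempty
  exact hgen ⟨∅, by simp⟩

theorem IsGenericLength.sum_pos (hgen : IsGenericLength ℓ) (hpos : ∀ k, 0 < ℓ k) :
    0 < ∑ k, ℓ k :=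
  have := hgen.nonempty
  Finset.sum_pos (fun k _ => hpos k) Finset.univ_nonempty

theorem IsGenericLength.eq_zero_of_sum_mul_eq_zero (hgen : IsGenericLength ℓ) {y : Fin n → ℝ}
    {s : ℝ} (hy : ∀ k, |y k| = s) (hsum : ∑ k, ℓ k * y k = 0) : s = 0 := by
  by_contra hs
  let J : Finset (Fin n) := {k | y k = s}
  have hJ : ∑ k ∈ J, ℓ k * y k = (∑ k ∈ J, ℓ k) * s := by
    rw [Finset.sum_mul]
    exact Finset.sum_congr rfl fun k hk => by rw [(Finset.mem_filter.1 hk).2]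
  have hJc : ∑ k ∈ Jᶜ, ℓ k * y k = (∑ k ∈ Jᶜ, ℓ k) * -s := by
    rw [Finset.sum_mul]
    refine Finset.sum_congr rfl fun k hk => ?_
    have hne : y k ≠ s := by simpa [J] using hk
    rw [(eq_or_eq_neg_of_abs_eq (hy k)).resolve_left hne]
  rw [← Finset.sum_add_sum_compl J, hJ, hJc, mul_neg, ← sub_eq_add_neg, ← sub_mul] at hsum
  exact hgen ⟨J, sub_eq_zero.1 ((mul_eq_zero.1 hsum).resolve_right hs)⟩

end GenericLengths

section ConformalCenters

variable {E : Type*} [NormedAddCommGroup E] [InnerProductSpace ℝ E]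
  {ι : Type*} [Fintype ι] {ℓ : ι → ℝ} {u : ι → E} {X : ℝ × E}

/-- `X` is the conformal barycenter of the points `u k` of the sphere at infinity with weights
`ℓ k`: the unit vectors at `X` pointing to the `u k` have weighted sum zero. The vector
`lightVector (u k)` divided by its product with `X` is the sum of `X` and the unit tangent vector
at `X` pointing to `u k`. -/
structure IsConformalCenter (ℓ : ι → ℝ) (u : ι → E) (X : ℝ × E) : Prop where
  norm_lt : ‖X.2‖ < X.1
  sum_smul : ∑ k, (ℓ k / lorentzForm X (lightVector (u k))) • lightVector (u k) = (∑ k, ℓ k) • X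

theorem isConformalCenter_one_zero_iff :
    IsConformalCenter ℓ u (1, 0) ↔ ∑ k, ℓ k • u k = 0 := by
  have hsum : ∑ k, (ℓ k / lorentzForm (1, 0) (lightVector (u k))) • lightVector (u k) =
      (∑ k, ℓ k, ∑ k, ℓ k • u k) := by
    simp only [lorentzForm_lightVector, inner_zero_left, sub_zero, div_one]
    simp [lightVector, Prod.ext_iff, Prod.fst_sum, Prod.snd_sum]
  refine ⟨fun h => ?_, fun h => ⟨by simp, by rw [hsum, h]; simp⟩⟩
  simpa using congrArg Prod.snd (hsum.symm.trans h.sum_smul)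

namespace IsConformalCenter

theorem sum_mul_div (h : IsConformalCenter ℓ u X) (Z : ℝ × E) :
    ∑ k, ℓ k * (lorentzForm Z (lightVector (u k)) / lorentzForm X (lightVector (u k))) =
      (∑ k, ℓ k) * lorentzForm Z X := by
  have hpair := congrArg (lorentzForm Z) h.sum_smul
  simp only [map_sum, map_smul, smul_eq_mul] at hpair
  rw [← hpair]
  exact Finset.sum_congr rfl fun k _ => by ring

theorem lorentzForm_self (h : IsConformalCenter ℓ u X) (hu : ∀ k, ‖u k‖ = 1)
    (hℓ : ∑ k, ℓ k ≠ 0) : lorentzForm X X = 1 := by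
  have hsum := h.sum_mul_div X
  simp only [div_self (lorentzForm_lightVector_pos h.norm_lt (hu _)).ne', mul_one] at hsum
  exact (mul_eq_left₀ hℓ).1 hsum.symm

theorem map (h : IsConformalCenter ℓ u X) {T : ℝ × E →ₗ[ℝ] ℝ × E} (hT : IsLorentzIsometry T)
    (hTu : ∀ k, (T (lightVector (u k))).1 ≠ 0) (hTX : ‖(T X).2‖ < (T X).1) :
    IsConformalCenter ℓ (fun k => direction (T (lightVector (u k)))) (T X) := by
  refine ⟨hTX, ?_⟩
  rw [← map_smul, ← h.sum_smul, map_sum]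
  refine Finset.sum_congr rfl fun k _ => ?_
  rw [lightVector_direction (hTu k), map_smul, map_smul, hT, smul_smul, smul_eq_mul,
    div_mul_eq_mul_div, mul_comm, mul_div_mul_left _ _ (inv_ne_zero (hTu k))]

end IsConformalCenter

end ConformalCenters

section Rigidity

variable {E : Type*} [NormedAddCommGroup E] [InnerProductSpace ℝ E]
  {n : ℕ} {ℓ : Fin n → ℝ} {u : Fin n → E} {X Y Z : ℝ × E}

namespace IsConformalCenter

theorem eq_lorentzForm_smul (h : IsConformalCenter ℓ u X) (hu : ∀ k, ‖u k‖ = 1)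
    (hℓ : ∑ k, ℓ k ≠ 0) (hgen : IsGenericLength ℓ)
    (heq : ∀ k, (lorentzForm Z (lightVector (u k)) / lorentzForm X (lightVector (u k)) -
      lorentzForm Z X) ^ 2 = lorentzForm Z X ^ 2 - lorentzForm Z Z) :
    Z = lorentzForm Z X • X := by
  have hsum : ∑ k, ℓ k * (lorentzForm Z (lightVector (u k)) / lorentzForm X (lightVector (u k)) -
      lorentzForm Z X) = 0 := by
    simp only [mul_sub, Finset.sum_sub_distrib]
    rw [h.sum_mul_div, Finset.sum_mul, sub_self]
  have hzero := hgen.eq_zero_of_sum_mul_eq_zero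
    (fun k => by rw [← Real.sqrt_sq_eq_abs, heq k]) hsum
  exact eq_lorentzForm_smul_of_sq_le h.norm_lt (h.lorentzForm_self hu hℓ)
    (sub_nonpos.1 (Real.sqrt_eq_zero'.1 hzero))

theorem unique (hX : IsConformalCenter ℓ u X) (hY : IsConformalCenter ℓ u Y)
    (hu : ∀ k, ‖u k‖ = 1) (hpos : ∀ k, 0 < ℓ k) (hgen : IsGenericLength ℓ) : X = Y := by
  have hℓ := (hgen.sum_pos hpos).ne'
  have hX1 := hX.lorentzForm_self hu hℓ
  have hY1 := hY.lorentzForm_self hu hℓ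
  set c := lorentzForm Y X
  let r : Fin n → ℝ := fun k =>
    lorentzForm Y (lightVector (u k)) / lorentzForm X (lightVector (u k))
  have hXu : ∀ k, 0 < lorentzForm X (lightVector (u k)) :=
    fun k => lorentzForm_lightVector_pos hX.norm_lt (hu k)
  have hr : ∀ k, 0 < r k := fun k =>
    div_pos (lorentzForm_lightVector_pos hY.norm_lt (hu k)) (hXu k)
  have hsum : ∑ k, ℓ k * (2 * c - r k - (r k)⁻¹) = 0 := by
    simp only [mul_sub, Finset.sum_sub_distrib, ← Finset.sum_mul]
    simp only [r, inv_div]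
    rw [hX.sum_mul_div, hY.sum_mul_div, lorentzForm_comm X Y]
    ring
  have hfactor : ∀ k, r k * (2 * c - r k - (r k)⁻¹) = c ^ 2 - 1 - (r k - c) ^ 2 := fun k => by
    rw [mul_sub, mul_inv_cancel₀ (hr k).ne']
    ring
  have hnonneg : ∀ k, 0 ≤ 2 * c - r k - (r k)⁻¹ := fun k => by
    refine nonneg_of_mul_nonneg_right (a := r k) ?_ (hr k)
    have hle := sq_lorentzForm_div_sub_le (Z := Y) hX1 (hu k) (hXu k).ne'
    rw [hY1] at hle
    exact (hfactor k).symm ▸ sub_nonneg.2 hle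
  have hzero := forall_eq_zero_of_sum_mul_eq_zero hpos hnonneg hsum
  have hYX : Y = c • X := hX.eq_lorentzForm_smul hu hℓ hgen fun k => by
    rw [hY1]
    linarith [hfactor k, congrArg (r k * ·) (hzero k)]
  have hc1 : c * c = 1 := by
    have hpair := congrArg (lorentzForm Y) hYX
    rw [hY1, map_smul, smul_eq_mul] at hpair
    exact hpair.symm
  have hcpos : 0 < c := lorentzForm_pos hY.norm_lt hX.norm_lt
  rw [hYX, (mul_self_eq_one_iff.1 hc1).resolve_right (by linarith), one_smul]

/-- The hypothesis says that `Z` lies in the kernel of the differential, at `X`, of the equation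
defining conformal barycenters. -/
theorem eq_zero_of_sum_add_eq_zero (h : IsConformalCenter ℓ u X) (hu : ∀ k, ‖u k‖ = 1)
    (hpos : ∀ k, 0 < ℓ k) (hgen : IsGenericLength ℓ)
    (hZ : ∑ k, (ℓ k * lorentzForm Z (lightVector (u k)) /
      lorentzForm X (lightVector (u k)) ^ 2) • lightVector (u k) + (∑ k, ℓ k) • Z = 0) :
    Z = 0 := by
  have hℓ := (hgen.sum_pos hpos).ne'
  have hX1 := h.lorentzForm_self hu hℓ
  have hXu : ∀ k, lorentzForm X (lightVector (u k)) ≠ 0 :=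
    fun k => (lorentzForm_lightVector_pos h.norm_lt (hu k)).ne'
  let b : Fin n → ℝ := fun k =>
    lorentzForm Z (lightVector (u k)) / lorentzForm X (lightVector (u k))
  have hZX : lorentzForm Z X = 0 := by
    have hpair := congrArg (lorentzForm X) hZ
    simp only [map_add, map_sum, map_smul, smul_eq_mul, map_zero, lorentzForm_comm X Z] at hpair
    have hb : ∑ k, ℓ k * lorentzForm Z (lightVector (u k)) /
        lorentzForm X (lightVector (u k)) ^ 2 * lorentzForm X (lightVector (u k)) =
        ∑ k, ℓ k * b k := Finset.sum_congr rfl fun k _ => by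
      have := hXu k
      simp only [b]
      field_simp
    rw [hb, h.sum_mul_div, ← two_mul] at hpair
    simpa [hℓ] using hpair
  have hsum : ∑ k, ℓ k * (-lorentzForm Z Z - b k ^ 2) = 0 := by
    have hpair := congrArg (lorentzForm Z) hZ
    simp only [map_add, map_sum, map_smul, smul_eq_mul, map_zero] at hpair
    have hb : ∑ k, ℓ k * lorentzForm Z (lightVector (u k)) /
        lorentzForm X (lightVector (u k)) ^ 2 * lorentzForm Z (lightVector (u k)) =
        ∑ k, ℓ k * b k ^ 2 := Finset.sum_congr rfl fun k _ => by simp only [b]; ring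
    rw [hb] at hpair
    simp only [mul_sub, Finset.sum_sub_distrib, ← Finset.sum_mul]
    linarith
  have hle : ∀ k, b k ^ 2 ≤ -lorentzForm Z Z := fun k => by
    simpa [hZX] using sq_lorentzForm_div_sub_le (Z := Z) hX1 (hu k) (hXu k)
  have hzero : ∀ k, -lorentzForm Z Z - b k ^ 2 = 0 :=
    forall_eq_zero_of_sum_mul_eq_zero hpos (fun k => sub_nonneg.2 (hle k)) hsum
  have hsmul := h.eq_lorentzForm_smul hu hℓ hgen (Z := Z) fun k => by
    rw [hZX]
    simp only [b] at hzero
    linarith [hzero k]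
  rwa [hZX, zero_smul] at hsmul

end IsConformalCenter

end Rigidity

section Hyperboloid

variable {E : Type*} [NormedAddCommGroup E]

/-- The point of the hyperboloid over `x`. -/
noncomputable def hyperboloidPoint (x : E) : ℝ × E := (√(1 + ‖x‖ ^ 2), x)

theorem norm_lt_hyperboloidPoint (x : E) :
    ‖(hyperboloidPoint x).2‖ < (hyperboloidPoint x).1 :=
  Real.lt_sqrt_of_sq_lt (lt_one_add _)

theorem continuous_hyperboloidPoint : Continuous (hyperboloidPoint : E → ℝ × E) := by
  unfold hyperboloidPoint
  fun_prop

variable [InnerProductSpace ℝ E]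

theorem lorentzForm_hyperboloidPoint_self (x : E) :
    lorentzForm (hyperboloidPoint x) (hyperboloidPoint x) = 1 := by
  rw [lorentzForm_self, hyperboloidPoint, Real.sq_sqrt (by positivity), add_sub_cancel_right]

theorem smul_hyperboloidPoint {Y : ℝ × E} (hY : ‖Y.2‖ < Y.1) :
    √(lorentzForm Y Y) • hyperboloidPoint ((√(lorentzForm Y Y))⁻¹ • Y.2) = Y := by
  have hpos := lorentzForm_pos hY hY
  refine Prod.ext ?_ (smul_inv_smul₀ (Real.sqrt_ne_zero'.2 hpos) _)
  simp only [hyperboloidPoint, Prod.smul_fst, smul_eq_mul]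
  rw [← Real.sqrt_mul hpos.le, norm_smul, norm_inv, Real.norm_of_nonneg (Real.sqrt_nonneg _),
    mul_pow, inv_pow, Real.sq_sqrt hpos.le, mul_add, mul_one, mul_inv_cancel_left₀ hpos.ne',
    lorentzForm_self, sub_add_cancel, Real.sqrt_sq ((norm_nonneg _).trans hY.le)]

end Hyperboloid

section BusemannEnergy

open scoped RealInnerProductSpace

variable {E : Type*} [NormedAddCommGroup E] [InnerProductSpace ℝ E]

theorem hasDerivAt_lorentzForm_add_smul (X Z W : ℝ × E) :
    HasDerivAt (fun s : ℝ => lorentzForm (X + s • Z) W) (lorentzForm Z W) 0 := by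
  simpa using ((hasDerivAt_id (0 : ℝ)).mul_const (lorentzForm Z W)).const_add (lorentzForm X W)

variable {ι : Type*} [Fintype ι] {ℓ : ι → ℝ} {u : ι → E} {X : ℝ × E}

/-- The weighted sum of the Busemann functions of the points `u k` of the sphere at infinity,
extended from the hyperboloid to the future cone by homogeneity of degree zero. -/
noncomputable def busemannEnergy (ℓ : ι → ℝ) (u : ι → E) (X : ℝ × E) : ℝ :=
  ∑ k, ℓ k * Real.log (lorentzForm X (lightVector (u k))) -
    (∑ k, ℓ k) / 2 * Real.log (lorentzForm X X)

theorem busemannEnergy_smul (hu : ∀ k, ‖u k‖ = 1) {c : ℝ} (hc : 0 < c) (hX : ‖X.2‖ < X.1) :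
    busemannEnergy ℓ u (c • X) = busemannEnergy ℓ u X := by
  have hlog : ∀ k, Real.log (c * lorentzForm X (lightVector (u k))) =
      Real.log c + Real.log (lorentzForm X (lightVector (u k))) := fun k =>
    Real.log_mul hc.ne' (lorentzForm_lightVector_pos hX (hu k)).ne'
  have hXX := (lorentzForm_pos hX hX).ne'
  simp only [busemannEnergy, map_smul, LinearMap.smul_apply, smul_eq_mul, hlog, mul_add,
    Finset.sum_add_distrib, ← Finset.sum_mul]
  rw [Real.log_mul hc.ne' (mul_ne_zero hc.ne' hXX), Real.log_mul hc.ne' hXX]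
  ring

theorem hasDerivAt_busemannEnergy_add_smul (hXu : ∀ k, lorentzForm X (lightVector (u k)) ≠ 0)
    (hX : lorentzForm X X ≠ 0) (Z : ℝ × E) :
    HasDerivAt (fun s : ℝ => busemannEnergy ℓ u (X + s • Z))
      (∑ k, ℓ k * (lorentzForm Z (lightVector (u k)) / lorentzForm X (lightVector (u k))) -
        (∑ k, ℓ k) / 2 * (2 * lorentzForm Z X / lorentzForm X X)) 0 := by
  have hquad : HasDerivAt (fun s : ℝ => lorentzForm (X + s • Z) (X + s • Z))
      (2 * lorentzForm Z X) 0 := by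
    have hexpand : ∀ s : ℝ, lorentzForm (X + s • Z) (X + s • Z) =
        lorentzForm X X + s * (2 * lorentzForm Z X) + s ^ 2 * lorentzForm Z Z := fun s => by
      simp only [map_add, map_smul, LinearMap.add_apply, LinearMap.smul_apply, smul_eq_mul,
        lorentzForm_comm X Z]
      ring
    simp only [hexpand]
    simpa using (((hasDerivAt_id (0 : ℝ)).mul_const (2 * lorentzForm Z X)).const_add
      (lorentzForm X X)).fun_add (((hasDerivAt_id (0 : ℝ)).fun_pow 2).mul_const (lorentzForm Z Z))
  refine (HasDerivAt.fun_sum fun k _ => ?_).fun_sub (HasDerivAt.const_mul _ ?_)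
  · simpa using ((hasDerivAt_lorentzForm_add_smul X Z _).log (by simpa using hXu k)).const_mul (ℓ k)
  · simpa using hquad.log (by simpa using hX)

theorem eq_zero_of_forall_lorentzForm_eq_zero {W : ℝ × E} (h : ∀ Z, lorentzForm Z W = 0) :
    W = 0 := by
  have hW := h (W.1, -W.2)
  rw [lorentzForm_apply, inner_neg_left, real_inner_self_eq_norm_sq, sub_neg_eq_add] at hW
  obtain ⟨hW1, hW2⟩ := (add_eq_zero_iff_of_nonneg (mul_self_nonneg W.1) (sq_nonneg ‖W.2‖)).1 hW
  exact Prod.ext (mul_self_eq_zero.1 hW1) (norm_eq_zero.1 (sq_eq_zero_iff.1 hW2))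

theorem isConformalCenter_of_isMinOn (hu : ∀ k, ‖u k‖ = 1) (hX : ‖X.2‖ < X.1)
    (hX1 : lorentzForm X X = 1)
    (hmin : IsMinOn (busemannEnergy ℓ u) {Y : ℝ × E | ‖Y.2‖ < Y.1} X) :
    IsConformalCenter ℓ u X := by
  refine ⟨hX, sub_eq_zero.1 (eq_zero_of_forall_lorentzForm_eq_zero fun Z => ?_)⟩
  have hcone : IsOpen {Y : ℝ × E | ‖Y.2‖ < Y.1} :=
    isOpen_lt continuous_snd.norm continuous_fst
  have hline : Filter.Tendsto (fun s : ℝ => X + s • Z) (nhds 0) (nhds X) :=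
    Continuous.tendsto' (by fun_prop) _ _ (by simp)
  have hlocal : IsLocalMin (fun s : ℝ => busemannEnergy ℓ u (X + s • Z)) 0 := by
    filter_upwards [hline.eventually (hcone.mem_nhds hX)] with s hs
    simpa using hmin hs
  have hderiv := hlocal.hasDerivAt_eq_zero <| hasDerivAt_busemannEnergy_add_smul
    (fun k => (lorentzForm_lightVector_pos hX (hu k)).ne') (hX1 ▸ one_ne_zero) Z
  simp only [map_sub, map_sum, map_smul, smul_eq_mul]
  rw [hX1, div_one, div_mul_eq_mul_div, mul_left_comm, mul_div_cancel_left₀ _ two_ne_zero]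
    at hderiv
  rw [← hderiv]
  simp only [mul_div_assoc', div_mul_eq_mul_div]

theorem isConformalCenter_hyperboloidPoint_of_forall_le (hu : ∀ k, ‖u k‖ = 1) {x : E}
    (hx : ∀ y, busemannEnergy ℓ u (hyperboloidPoint x) ≤ busemannEnergy ℓ u (hyperboloidPoint y)) :
    IsConformalCenter ℓ u (hyperboloidPoint x) := by
  refine isConformalCenter_of_isMinOn hu (norm_lt_hyperboloidPoint x)
    (lorentzForm_hyperboloidPoint_self x) fun Y (hY : ‖Y.2‖ < Y.1) => ?_
  rw [Set.mem_ofPred_eq, ← smul_hyperboloidPoint hY, busemannEnergy_smul hu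
    (Real.sqrt_pos.2 (lorentzForm_pos hY hY)) (norm_lt_hyperboloidPoint _)]
  exact hx _

theorem busemannEnergy_hyperboloidPoint (x : E) : busemannEnergy ℓ u (hyperboloidPoint x) =
    ∑ k, ℓ k * Real.log (lorentzForm (hyperboloidPoint x) (lightVector (u k))) := by
  rw [busemannEnergy, lorentzForm_hyperboloidPoint_self, Real.log_one, mul_zero, sub_zero]

theorem continuous_busemannEnergy_hyperboloidPoint (hu : ∀ k, ‖u k‖ = 1) :
    Continuous fun x => busemannEnergy ℓ u (hyperboloidPoint x) := by
  simp only [busemannEnergy_hyperboloidPoint]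
  refine continuous_finsetSum _ fun k _ => continuous_const.mul (Continuous.log ?_ fun x =>
    (lorentzForm_lightVector_pos (norm_lt_hyperboloidPoint x) (hu k)).ne')
  simp only [lorentzForm_lightVector]
  exact continuous_hyperboloidPoint.fst.sub (continuous_hyperboloidPoint.snd.inner continuous_const)

end BusemannEnergy

section StableConfigurations

variable {ι E : Type*} [Fintype ι] {ℓ : ι → ℝ} {u : ι → E}

open Classical in
/-- Stability of a weighted point configuration: every point carries less than half of the total
weight. -/
def IsStableConfiguration (ℓ : ι → ℝ) (u : ι → E) : Prop :=
  ∀ v, ∑ k with u k = v, ℓ k < ∑ k with u k ≠ v, ℓ k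

theorem IsStableConfiguration.nonempty [Zero E] (hstable : IsStableConfiguration ℓ u) :
    Nonempty ι := by
  by_contra hempty
  have := not_nonempty_iff.1 hempty
  simpa using hstable 0

end StableConfigurations

section Existence

open scoped RealInnerProductSpace
open Filter

open Classical in
/-- A lower bound for `busemannEnergy` at a point of the hyperboloid of height `t` for which `u j`
is the closest of the points at infinity. -/
noncomputable def energyMinorant {ι E : Type*} [Fintype ι]
    [NormedAddCommGroup E] (ℓ : ι → ℝ) (u : ι → E) (j : ι) (t : ℝ) : ℝ :=
  ∑ k, ℓ k * if u k = u j then Real.log (2 * t)⁻¹ else Real.log (t * (2 - ‖u j + u k‖) / 2)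

variable {E : Type*} [NormedAddCommGroup E] [InnerProductSpace ℝ E]

theorem inv_two_mul_le_lorentzForm_hyperboloidPoint (x : E) {v : E} (hv : ‖v‖ = 1) :
    (2 * (hyperboloidPoint x).1)⁻¹ ≤ lorentzForm (hyperboloidPoint x) (lightVector v) := by
  set t := (hyperboloidPoint x).1
  have hlt : ‖x‖ < t := norm_lt_hyperboloidPoint x
  have hfactor : (t - ‖x‖) * (t + ‖x‖) = 1 := by
    rw [← lorentzForm_hyperboloidPoint_self x, lorentzForm_self]
    simp only [t, hyperboloidPoint]
    ring
  have hinner : ⟪x, v⟫ ≤ ‖x‖ := by simpa [hv] using real_inner_le_norm x v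
  calc (2 * t)⁻¹ ≤ (t + ‖x‖)⁻¹ :=
        inv_anti₀ (by linarith [norm_nonneg x]) (by linarith)
    _ = t - ‖x‖ := (eq_inv_of_mul_eq_one_left hfactor).symm
    _ ≤ lorentzForm (hyperboloidPoint x) (lightVector v) := by
        rw [lorentzForm_lightVector]
        exact sub_le_sub_left hinner t

theorem mul_le_add_lorentzForm_hyperboloidPoint (x v w : E) :
    (hyperboloidPoint x).1 * (2 - ‖v + w‖) ≤ lorentzForm (hyperboloidPoint x) (lightVector v) +
      lorentzForm (hyperboloidPoint x) (lightVector w) := by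
  have hinner : ⟪x, v + w⟫ ≤ (hyperboloidPoint x).1 * ‖v + w‖ :=
    (real_inner_le_norm _ _).trans
      (mul_le_mul_of_nonneg_right (norm_lt_hyperboloidPoint x).le (norm_nonneg _))
  rw [lorentzForm_lightVector, lorentzForm_lightVector]
  rw [inner_add_right] at hinner
  simp only [hyperboloidPoint] at hinner ⊢
  linarith

theorem norm_add_lt_two {v w : E} (hv : ‖v‖ = 1) (hw : ‖w‖ = 1) (hvw : v ≠ w) : ‖v + w‖ < 2 := by
  have hlt := norm_add_lt_of_not_sameRay (x := v) (y := w)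
    ((not_sameRay_iff_of_norm_eq (hv.trans hw.symm)).2 hvw)
  rwa [hv, hw, one_add_one_eq_two] at hlt

variable {ι : Type*} [Fintype ι] {ℓ : ι → ℝ} {u : ι → E}

theorem tendsto_energyMinorant (hu : ∀ k, ‖u k‖ = 1) (hstable : IsStableConfiguration ℓ u)
    (j : ι) : Tendsto (energyMinorant ℓ u j) atTop atTop := by
  classical
  let C : ℝ := ∑ k, ℓ k * if u k = u j then -Real.log 2 else Real.log ((2 - ‖u j + u k‖) / 2)
  let σ : ℝ := ∑ k with u k ≠ u j, ℓ k - ∑ k with u k = u j, ℓ k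
  have heq : ∀ᶠ t in atTop, C + σ * Real.log t = energyMinorant ℓ u j t := by
    filter_upwards [eventually_gt_atTop 0] with t ht
    have hσ : σ * Real.log t = ∑ k, ℓ k * if u k = u j then -Real.log t else Real.log t := by
      simp only [σ, sub_mul, Finset.sum_mul, Finset.sum_filter, ← Finset.sum_sub_distrib]
      refine Finset.sum_congr rfl fun k _ => ?_
      split_ifs <;> simp_all
    rw [hσ, energyMinorant, ← Finset.sum_add_distrib]
    refine Finset.sum_congr rfl fun k _ => ?_
    rw [← mul_add]
    congr 1
    split_ifs with hk
    · rw [Real.log_inv, Real.log_mul two_ne_zero ht.ne', neg_add]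
    · have hlt := norm_add_lt_two (hu j) (hu k) (Ne.symm hk)
      rw [mul_div_assoc, Real.log_mul ht.ne' (by linarith), add_comm]
  refine Tendsto.congr' heq (tendsto_atTop_add_const_left _ _ ?_)
  exact Real.tendsto_log_atTop.const_mul_atTop (sub_pos.2 (hstable (u j)))

theorem energyMinorant_le_busemannEnergy (hℓ : ∀ k, 0 ≤ ℓ k) (hu : ∀ k, ‖u k‖ = 1) (x : E) {j : ι}
    (hj : ∀ k, lorentzForm (hyperboloidPoint x) (lightVector (u j)) ≤
      lorentzForm (hyperboloidPoint x) (lightVector (u k))) :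
    energyMinorant ℓ u j (hyperboloidPoint x).1 ≤ busemannEnergy ℓ u (hyperboloidPoint x) := by
  have ht : 0 < (hyperboloidPoint x).1 := (norm_nonneg _).trans_lt (norm_lt_hyperboloidPoint x)
  rw [busemannEnergy_hyperboloidPoint, energyMinorant]
  refine Finset.sum_le_sum fun k _ => mul_le_mul_of_nonneg_left ?_ (hℓ k)
  split_ifs with hk
  · exact Real.log_le_log (by positivity) (inv_two_mul_le_lorentzForm_hyperboloidPoint x (hu k))
  · have hlt := norm_add_lt_two (hu j) (hu k) (Ne.symm hk)
    refine Real.log_le_log (half_pos (mul_pos ht (sub_pos.2 hlt))) ?_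
    linarith [hj k, mul_le_add_lorentzForm_hyperboloidPoint x (u j) (u k)]

theorem tendsto_busemannEnergy_cocompact [FiniteDimensional ℝ E] (hℓ : ∀ k, 0 ≤ ℓ k)
    (hu : ∀ k, ‖u k‖ = 1) (hstable : IsStableConfiguration ℓ u) :
    Tendsto (fun x => busemannEnergy ℓ u (hyperboloidPoint x)) (cocompact E) atTop := by
  have := FiniteDimensional.proper_real E
  have := hstable.nonempty
  have hheight : Tendsto (fun x : E => (hyperboloidPoint x).1) (cocompact E) atTop :=
    tendsto_atTop_mono (fun x => (norm_lt_hyperboloidPoint x).le) tendsto_norm_cocompact_atTop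
  refine tendsto_atTop.2 fun b => ?_
  have hminorant : ∀ᶠ x in cocompact E, ∀ j, b ≤ energyMinorant ℓ u j (hyperboloidPoint x).1 :=
    eventually_all.2 fun j =>
      ((tendsto_energyMinorant hu hstable j).comp hheight).eventually_ge_atTop b
  filter_upwards [hminorant] with x hx
  obtain ⟨j, hj⟩ := Finite.exists_min fun k =>
    lorentzForm (hyperboloidPoint x) (lightVector (u k))
  exact (hx j).trans (energyMinorant_le_busemannEnergy hℓ hu x hj)

theorem IsStableConfiguration.exists_isConformalCenter [FiniteDimensional ℝ E]
    (hstable : IsStableConfiguration ℓ u) (hℓ : ∀ k, 0 ≤ ℓ k) (hu : ∀ k, ‖u k‖ = 1) :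
    ∃ X, IsConformalCenter ℓ u X := by
  obtain ⟨x, hx⟩ := (continuous_busemannEnergy_hyperboloidPoint hu).exists_forall_le
    (tendsto_busemannEnergy_cocompact hℓ hu hstable)
  exact ⟨_, isConformalCenter_hyperboloidPoint_of_forall_le hu hx⟩

open Classical in
theorem sum_filter_eq_le_sum_filter_ne (hℓ : ∀ k, 0 ≤ ℓ k) (hu : ∀ k, ‖u k‖ = 1)
    (hsum : ∑ k, ℓ k • u k = 0) (v : E) :
    ∑ k with u k = v, ℓ k ≤ ∑ k with u k ≠ v, ℓ k := by
  by_cases hv : ‖v‖ = 1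
  · have hinner : ∑ k with u k = v, ℓ k * ⟪u k, v⟫ + ∑ k with u k ≠ v, ℓ k * ⟪u k, v⟫ = 0 := by
      rw [Finset.sum_filter_add_sum_filter_not]
      simpa only [sum_inner, real_inner_smul_left, inner_zero_left] using
        congrArg (⟪·, v⟫) hsum
    have heq : ∑ k with u k = v, ℓ k * ⟪u k, v⟫ = ∑ k with u k = v, ℓ k :=
      Finset.sum_congr rfl fun k hk => by
        rw [(Finset.mem_filter.1 hk).2, real_inner_self_eq_norm_sq, hv, one_pow, mul_one]
    have hge : -∑ k with u k ≠ v, ℓ k ≤ ∑ k with u k ≠ v, ℓ k * ⟪u k, v⟫ := by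
      rw [← Finset.sum_neg_distrib]
      refine Finset.sum_le_sum fun k _ => ?_
      have habs := abs_real_inner_le_norm (u k) v
      rw [hu, hv, mul_one] at habs
      nlinarith [hℓ k, neg_le_of_abs_le habs]
    linarith
  · have hempty : ∀ k, u k ≠ v := fun k hk => hv (hk ▸ hu k)
    simpa [hempty] using Finset.sum_nonneg fun k _ => hℓ k

theorem SameChamber.isStableConfiguration {n : ℕ} {ℓ ℓ' : Fin n → ℝ} {u : Fin n → E}
    (hchamber : SameChamber ℓ ℓ') (hℓ : ∀ k, 0 ≤ ℓ k) (hgen' : IsGenericLength ℓ')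
    (hu : ∀ k, ‖u k‖ = 1) (hsum : ∑ k, ℓ k • u k = 0) : IsStableConfiguration ℓ' u := by
  classical
  intro v
  have hshort := (sum_filter_eq_le_sum_filter_ne hℓ hu hsum v).not_gt
  simp only [ne_eq, ← Finset.compl_filter] at hshort ⊢
  exact (not_lt.1 ((hchamber _).not.1 hshort)).lt_of_ne fun heq => hgen' ⟨_, heq⟩

end Existence

section CenterSmoothness

open Filter Topology

variable {E : Type*} [NormedAddCommGroup E] [InnerProductSpace ℝ E]

theorem contDiff_lorentzForm {m : WithTop ℕ∞} :
    ContDiff ℝ m fun p : (ℝ × E) × (ℝ × E) => lorentzForm p.1 p.2 :=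
  (contDiff_fst.fst.mul contDiff_snd.fst).sub (contDiff_fst.snd.inner ℝ contDiff_snd.snd)

section ConformalCenter

variable {ι : Type*} [Fintype ι]

open Classical in
/-- A conformal barycenter of the points `u k` with weights `ℓ k`, or `0` if there is none. -/
noncomputable def conformalCenter (ℓ : ι → ℝ) (u : ι → E) : ℝ × E :=
  if h : ∃ X, IsConformalCenter ℓ u X then h.choose else 0

theorem isConformalCenter_conformalCenter {ℓ : ι → ℝ} {u : ι → E}
    (h : ∃ X, IsConformalCenter ℓ u X) : IsConformalCenter ℓ u (conformalCenter ℓ u) := by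
  rw [conformalCenter, dif_pos h]
  exact h.choose_spec

/-- The amount by which `p.2` fails to be a conformal barycenter of the points `p.1 k` with weights
`ℓ k`. -/
noncomputable def balancingDefect (ℓ : ι → ℝ) (p : (ι → E) × (ℝ × E)) : ℝ × E :=
  ∑ k, (ℓ k / lorentzForm p.2 (lightVector (p.1 k))) • lightVector (p.1 k) - (∑ k, ℓ k) • p.2

theorem contDiffAt_balancingDefect (ℓ : ι → ℝ) {p : (ι → E) × (ℝ × E)}
    (hp : ∀ k, lorentzForm p.2 (lightVector (p.1 k)) ≠ 0) :
    ContDiffAt ℝ ∞ (balancingDefect ℓ) p := by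
  have hpoint : ∀ k, ContDiffAt ℝ ∞ (fun p : (ι → E) × (ℝ × E) => p.1 k) p := fun k =>
    (contDiff_apply ℝ E k).contDiffAt.comp p contDiffAt_fst
  have hlight : ∀ k, ContDiffAt ℝ ∞
      (fun p : (ι → E) × (ℝ × E) => lightVector (p.1 k)) p := fun k =>
    contDiffAt_const.prodMk (hpoint k)
  refine ContDiffAt.sub (ContDiffAt.sum fun k _ => ContDiffAt.fun_smul
    (contDiffAt_const.div ?_ (hp k)) (hlight k)) (contDiffAt_snd.const_smul _)
  exact contDiff_lorentzForm.contDiffAt.fun_comp p (contDiffAt_snd.prodMk (hlight k))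

theorem fderiv_balancingDefect_inr (ℓ : ι → ℝ) {u : ι → E} {X : ℝ × E}
    (hX : ∀ k, lorentzForm X (lightVector (u k)) ≠ 0) (Z : ℝ × E) :
    fderiv ℝ (balancingDefect ℓ) (u, X) (0, Z) =
      -(∑ k, (ℓ k * lorentzForm Z (lightVector (u k)) /
        lorentzForm X (lightVector (u k)) ^ 2) • lightVector (u k) + (∑ k, ℓ k) • Z) := by
  have hweight : ∀ k, HasDerivAt (fun s : ℝ => ℓ k / lorentzForm (X + s • Z) (lightVector (u k)))
      (-(ℓ k * lorentzForm Z (lightVector (u k))) / lorentzForm X (lightVector (u k)) ^ 2) 0 :=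
    fun k => by
      simpa using (hasDerivAt_const (0 : ℝ) (ℓ k)).fun_div
        (hasDerivAt_lorentzForm_add_smul X Z _) (by simpa using hX k)
  have hline : HasDerivAt (fun s : ℝ => X + s • Z) Z 0 := by
    simpa using ((hasDerivAt_id (0 : ℝ)).smul_const Z).const_add X
  have hdefect : HasLineDerivAt ℝ (balancingDefect ℓ) _ (u, X) (0, Z) :=
    ((HasDerivAt.fun_sum fun k (_ : k ∈ Finset.univ) =>
      (hweight k).smul_const (lightVector (u k))).sub
        (hline.fun_const_smul (∑ k, ℓ k))).congr_of_eventuallyEq <| .of_forall fun s => by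
          simp [balancingDefect]
  have hdiff := (contDiffAt_balancingDefect ℓ (p := (u, X)) hX).differentiableAt (by simp)
  rw [← hdiff.lineDeriv_eq_fderiv, hdefect.lineDeriv, neg_add, ← Finset.sum_neg_distrib,
    ← sub_eq_add_neg]
  simp only [neg_div, neg_smul]

end ConformalCenter

variable {n : ℕ} {ℓ : Fin n → ℝ} {u : Fin n → E} {X : ℝ × E}

theorem IsConformalCenter.conformalCenter_eq (h : IsConformalCenter ℓ u X) (hu : ∀ k, ‖u k‖ = 1)
    (hpos : ∀ k, 0 < ℓ k) (hgen : IsGenericLength ℓ) : conformalCenter ℓ u = X :=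
  (isConformalCenter_conformalCenter ⟨X, h⟩).unique h hu hpos hgen

theorem IsConformalCenter.isInvertible_fderiv_balancingDefect [FiniteDimensional ℝ E]
    (h : IsConformalCenter ℓ u X) (hu : ∀ k, ‖u k‖ = 1) (hpos : ∀ k, 0 < ℓ k)
    (hgen : IsGenericLength ℓ) : (fderiv ℝ (balancingDefect ℓ) (u, X) ∘L
      .inr ℝ (Fin n → E) (ℝ × E)).IsInvertible := by
  set A := fderiv ℝ (balancingDefect ℓ) (u, X) ∘L .inr ℝ (Fin n → E) (ℝ × E)
  have hinj : Function.Injective (A : ℝ × E →ₗ[ℝ] ℝ × E) := by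
    refine (injective_iff_map_eq_zero _).2 fun Z hZ =>
      h.eq_zero_of_sum_add_eq_zero hu hpos hgen (neg_eq_zero.1 ?_)
    exact (fderiv_balancingDefect_inr ℓ
      (fun k => (lorentzForm_lightVector_pos h.norm_lt (hu k)).ne') Z).symm.trans hZ
  exact ⟨(LinearEquiv.ofInjectiveEndo _ hinj).toContinuousLinearEquiv, rfl⟩

theorem IsConformalCenter.exists_contDiffAt [FiniteDimensional ℝ E]
    (h : IsConformalCenter ℓ u X) (hu : ∀ k, ‖u k‖ = 1) (hpos : ∀ k, 0 < ℓ k)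
    (hgen : IsGenericLength ℓ) : ∃ ψ : (Fin n → E) → ℝ × E, ContDiffAt ℝ ∞ ψ u ∧
      ∀ᶠ w in 𝓝 u, IsConformalCenter ℓ w (ψ w) := by
  have := FiniteDimensional.complete ℝ E
  have hsmooth := contDiffAt_balancingDefect (p := (u, X)) ℓ
    fun k => (lorentzForm_lightVector_pos h.norm_lt (hu k)).ne'
  have hinv := h.isInvertible_fderiv_balancingDefect hu hpos hgen
  have hn : (∞ : WithTop ℕ∞) ≠ 0 := by simp
  let ψ := hsmooth.implicitFunction hn hinv
  have hψ : ContDiffAt ℝ ∞ ψ u := hsmooth.contDiffAt_implicitFunction hn hinv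
  have hψu : ψ u = X := hsmooth.implicitFunction_apply_self hn hinv
  have hzero : balancingDefect ℓ (u, X) = 0 := sub_eq_zero.2 h.sum_smul
  have hcone : ∀ᶠ w in 𝓝 u, ‖(ψ w).2‖ < (ψ w).1 :=
    hψ.continuousAt.snd.norm.eventually_lt hψ.continuousAt.fst (by rw [hψu]; exact h.norm_lt)
  refine ⟨ψ, hψ, ?_⟩
  filter_upwards [hsmooth.eventually_apply_implicitFunction hn hinv, hcone] with w hw hw'
  exact ⟨hw', sub_eq_zero.1 (hw.trans hzero)⟩

theorem contDiffOn_conformalCenter [FiniteDimensional ℝ E] (hpos : ∀ k, 0 < ℓ k)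
    (hgen : IsGenericLength ℓ) : ContDiffOn ℝ ∞ (conformalCenter ℓ)
      {u : Fin n → E | (∀ k, ‖u k‖ = 1) ∧ ∃ X, IsConformalCenter ℓ u X} := by
  rintro u ⟨hu, hX⟩
  obtain ⟨ψ, hψ, hcenter⟩ :=
    (isConformalCenter_conformalCenter hX).exists_contDiffAt hu hpos hgen
  refine hψ.contDiffWithinAt.congr_of_eventuallyEq ?_
    (hcenter.self_of_nhds.conformalCenter_eq hu hpos hgen)
  filter_upwards [eventually_nhdsWithin_of_eventually_nhds hcenter, self_mem_nhdsWithin]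
    with w hψw hw
  exact hψw.conformalCenter_eq hw.1 hpos hgen

end CenterSmoothness

section BalancedPolygons

variable {E : Type*} [NormedAddCommGroup E] [InnerProductSpace ℝ E]

theorem lorentzForm_add_one_zero_self_ne_zero {X : ℝ × E} (hX : ‖X.2‖ < X.1) :
    lorentzForm (X + (1, 0)) (X + (1, 0)) ≠ 0 := by
  have hcone : ‖(X + (1, 0)).2‖ < (X + (1, 0)).1 := by
    rw [Prod.snd_add, Prod.fst_add, add_zero]
    exact hX.trans (lt_add_one X.1)
  exact (lorentzForm_pos hcone hcone).ne'

theorem halfTurn_add_one_zero_one_zero {X : ℝ × E} (hX : ‖X.2‖ < X.1)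
    (hX1 : lorentzForm X X = 1) : halfTurn (X + (1, 0)) (1, 0) = X :=
  halfTurn_add_apply_right (hX1.trans (lorentzForm_one_zero (1, 0)).symm)
    (lorentzForm_add_one_zero_self_ne_zero hX)

theorem halfTurn_add_one_zero_self {X : ℝ × E} (hX : ‖X.2‖ < X.1)
    (hX1 : lorentzForm X X = 1) : halfTurn (X + (1, 0)) X = (1, 0) :=
  halfTurn_add_apply_left (hX1.trans (lorentzForm_one_zero (1, 0)).symm)
    (lorentzForm_add_one_zero_self_ne_zero hX)

theorem fst_halfTurn_add_one_zero {X : ℝ × E} (hX : ‖X.2‖ < X.1) (hX1 : lorentzForm X X = 1)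
    (v : ℝ × E) : (halfTurn (X + (1, 0)) v).1 = lorentzForm X v := by
  have hform := isLorentzIsometry_halfTurn (lorentzForm_add_one_zero_self_ne_zero hX) v X
  rwa [halfTurn_add_one_zero_self hX hX1, lorentzForm_one_zero, lorentzForm_comm v] at hform

section Configurations

variable {ι : Type*} [Fintype ι]

/-- The points `u k` moved by the half-turn of hyperbolic space that exchanges their conformal
barycenter with the origin `(1, 0)`. -/
noncomputable def balancedPolygon (ℓ : ι → ℝ) (u : ι → E) (k : ι) : E :=
  direction (halfTurn (conformalCenter ℓ u + (1, 0)) (lightVector (u k)))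

variable {ℓ : ι → ℝ} {u : ι → E}

theorem fst_halfTurn_conformalCenter_pos (hu : ∀ k, ‖u k‖ = 1) (hℓ : ∑ k, ℓ k ≠ 0)
    (hX : ∃ X, IsConformalCenter ℓ u X) (k : ι) :
    0 < (halfTurn (conformalCenter ℓ u + (1, 0)) (lightVector (u k))).1 := by
  have hc := isConformalCenter_conformalCenter hX
  rw [fst_halfTurn_add_one_zero hc.norm_lt (hc.lorentzForm_self hu hℓ)]
  exact lorentzForm_lightVector_pos hc.norm_lt (hu k)

theorem norm_balancedPolygon (hu : ∀ k, ‖u k‖ = 1) (hℓ : ∑ k, ℓ k ≠ 0)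
    (hX : ∃ X, IsConformalCenter ℓ u X) (k : ι) : ‖balancedPolygon ℓ u k‖ = 1 := by
  refine norm_direction ?_ (fst_halfTurn_conformalCenter_pos hu hℓ hX k).ne'
  rw [isLorentzIsometry_halfTurn (lorentzForm_add_one_zero_self_ne_zero
    (isConformalCenter_conformalCenter hX).norm_lt), lorentzForm_lightVector_self (hu k)]

theorem IsConformalCenter.halfTurn_conformalCenter {ℓ' : ι → ℝ} {Y : ℝ × E}
    (hY : IsConformalCenter ℓ' u Y) (hu : ∀ k, ‖u k‖ = 1) (hℓ : ∑ k, ℓ k ≠ 0)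
    (hX : ∃ X, IsConformalCenter ℓ u X)
    (hcone : ‖(halfTurn (conformalCenter ℓ u + (1, 0)) Y).2‖ <
      (halfTurn (conformalCenter ℓ u + (1, 0)) Y).1) :
    IsConformalCenter ℓ' (balancedPolygon ℓ u) (halfTurn (conformalCenter ℓ u + (1, 0)) Y) :=
  hY.map (isLorentzIsometry_halfTurn (lorentzForm_add_one_zero_self_ne_zero
    (isConformalCenter_conformalCenter hX).norm_lt))
    (fun k => (fst_halfTurn_conformalCenter_pos hu hℓ hX k).ne') hcone

theorem sum_smul_balancedPolygon (hu : ∀ k, ‖u k‖ = 1) (hℓ : ∑ k, ℓ k ≠ 0)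
    (hX : ∃ X, IsConformalCenter ℓ u X) : ∑ k, ℓ k • balancedPolygon ℓ u k = 0 := by
  have hc := isConformalCenter_conformalCenter hX
  have hswap := halfTurn_add_one_zero_self hc.norm_lt (hc.lorentzForm_self hu hℓ)
  have hmap := hc.halfTurn_conformalCenter hu hℓ hX (by simp [hswap])
  rwa [hswap, isConformalCenter_one_zero_iff] at hmap

theorem isConformalCenter_balancedPolygon_of_sum_smul_eq_zero {ℓ' : ι → ℝ} (hu : ∀ k, ‖u k‖ = 1)
    (hℓ' : ∑ k, ℓ' k ≠ 0) (hX : ∃ X, IsConformalCenter ℓ' u X) (hsum : ∑ k, ℓ k • u k = 0) :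
    IsConformalCenter ℓ (balancedPolygon ℓ' u) (conformalCenter ℓ' u) := by
  have hc := isConformalCenter_conformalCenter hX
  have hswap := halfTurn_add_one_zero_one_zero hc.norm_lt (hc.lorentzForm_self hu hℓ')
  have hmap := (isConformalCenter_one_zero_iff.2 hsum).halfTurn_conformalCenter hu hℓ'
    hX (by rw [hswap]; exact hc.norm_lt)
  rwa [hswap] at hmap

end Configurations

variable {n : ℕ} {ℓ ℓ' : Fin n → ℝ} {u : Fin n → E}

theorem balancedPolygon_balancedPolygon (hpos : ∀ k, 0 < ℓ k) (hgen : IsGenericLength ℓ)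
    (hu : ∀ k, ‖u k‖ = 1) (hℓ' : ∑ k, ℓ' k ≠ 0) (hX : ∃ X, IsConformalCenter ℓ' u X)
    (hsum : ∑ k, ℓ k • u k = 0) : balancedPolygon ℓ (balancedPolygon ℓ' u) = u := by
  have hcenter : conformalCenter ℓ (balancedPolygon ℓ' u) = conformalCenter ℓ' u :=
    (isConformalCenter_balancedPolygon_of_sum_smul_eq_zero hu hℓ' hX hsum).conformalCenter_eq
      (norm_balancedPolygon hu hℓ' hX) hpos hgen
  funext k
  have hfst := (fst_halfTurn_conformalCenter_pos hu hℓ' hX k).ne'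
  rw [balancedPolygon, hcenter, balancedPolygon, lightVector_direction hfst, map_smul,
    direction_smul (inv_ne_zero hfst), halfTurn_halfTurn (lorentzForm_add_one_zero_self_ne_zero
      (isConformalCenter_conformalCenter hX).norm_lt), direction_lightVector]

theorem conformalCenter_map (hpos : ∀ k, 0 < ℓ k) (hgen : IsGenericLength ℓ)
    (hu : ∀ k, ‖u k‖ = 1) (hX : ∃ X, IsConformalCenter ℓ u X) (g : E →ₗᵢ[ℝ] E) :
    conformalCenter ℓ (fun k => g (u k)) = spatialMap g (conformalCenter ℓ u) := by
  have hc := isConformalCenter_conformalCenter hX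
  have hmap := hc.map (isLorentzIsometry_spatialMap g) (fun _ => one_ne_zero)
    (by simpa [spatialMap] using hc.norm_lt)
  simp only [direction_spatialMap, direction_lightVector] at hmap
  exact hmap.conformalCenter_eq (fun k => by rw [g.norm_map, hu]) hpos hgen

theorem balancedPolygon_map (hpos : ∀ k, 0 < ℓ k) (hgen : IsGenericLength ℓ)
    (hu : ∀ k, ‖u k‖ = 1) (hX : ∃ X, IsConformalCenter ℓ u X) (g : E →ₗᵢ[ℝ] E) (k : Fin n) :
    balancedPolygon ℓ (fun k => g (u k)) k = g (balancedPolygon ℓ u k) := by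
  have hmid : spatialMap g (conformalCenter ℓ u) + (1, 0) =
      spatialMap g (conformalCenter ℓ u + (1, 0)) := by simp [spatialMap]
  rw [balancedPolygon, balancedPolygon, conformalCenter_map hpos hgen hu hX, hmid,
    ← direction_spatialMap, spatialMap_halfTurn]
  rfl

theorem contDiffOn_balancedPolygon [FiniteDimensional ℝ E] (hpos : ∀ k, 0 < ℓ k)
    (hgen : IsGenericLength ℓ) : ContDiffOn ℝ ∞ (balancedPolygon ℓ)
      {u : Fin n → E | (∀ k, ‖u k‖ = 1) ∧ ∃ X, IsConformalCenter ℓ u X} := by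
  have hM := (contDiffOn_conformalCenter hpos hgen).add
    (contDiffOn_const (c := ((1 : ℝ), (0 : E))))
  refine contDiffOn_pi.2 fun k => ?_
  have hlight : ContDiff ℝ ∞ fun u : Fin n → E => lightVector (u k) :=
    contDiff_const.prodMk (contDiff_apply ℝ E k)
  have hturn : ContDiffOn ℝ ∞
      (fun u => halfTurn (conformalCenter ℓ u + (1, 0)) (lightVector (u k)))
      {u : Fin n → E | (∀ k, ‖u k‖ = 1) ∧ ∃ X, IsConformalCenter ℓ u X} := by
    simp only [halfTurn_apply]
    refine (((contDiffOn_const.div (contDiff_lorentzForm.comp_contDiffOn (hM.prodMk hM))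
      fun u hu => ?_).mul (contDiff_lorentzForm.comp_contDiffOn
        (hM.prodMk hlight.contDiffOn))).smul hM).sub hlight.contDiffOn
    exact lorentzForm_add_one_zero_self_ne_zero (isConformalCenter_conformalCenter hu.2).norm_lt
  exact (hturn.fst.inv fun u hu => (fst_halfTurn_conformalCenter_pos hu.1
    (hgen.sum_pos hpos).ne' hu.2 k).ne').smul hturn.snd

end BalancedPolygons

section PolygonMap

open scoped RealInnerProductSpace
open Module

variable {E : Type*} [NormedAddCommGroup E]

/-- The map whose zeros are the closed polygons with side lengths `ℓ`. -/
def polygonMap {ι : Type*} [Fintype ι] [NormedSpace ℝ E] (ℓ : ι → ℝ) (u : ι → E) : (ι → ℝ) × E :=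
  (fun k => ‖u k‖ ^ 2 - 1, ∑ k, ℓ k • u k)

theorem polygonMap_eq_zero_iff {ι : Type*} [Fintype ι] [NormedSpace ℝ E] {ℓ : ι → ℝ} {u : ι → E} :
    polygonMap ℓ u = 0 ↔ (∀ k, ‖u k‖ = 1) ∧ ∑ k, ℓ k • u k = 0 := by
  rw [polygonMap, Prod.mk_eq_zero, funext_iff]
  refine and_congr_left fun _ => forall_congr' fun k => ?_
  rw [Pi.zero_apply, sub_eq_zero, pow_eq_one_iff_of_nonneg (norm_nonneg _) two_ne_zero]

variable [InnerProductSpace ℝ E]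

theorem contDiff_polygonMap {ι : Type*} [Fintype ι] (ℓ : ι → ℝ) :
    ContDiff ℝ ∞ (polygonMap (E := E) ℓ) :=
  (contDiff_pi.2 fun k => ((contDiff_apply ℝ E k).norm_sq ℝ).sub contDiff_const).prodMk
    (ContDiff.sum fun k _ => (contDiff_apply ℝ E k).const_smul (ℓ k))

theorem fderiv_polygonMap {ι : Type*} [Fintype ι] (ℓ : ι → ℝ) (u v : ι → E) :
    fderiv ℝ (polygonMap ℓ) u v = (fun k => 2 * ⟪u k, v k⟫, ∑ k, ℓ k • v k) := by
  have hline : ∀ k, HasDerivAt (fun s : ℝ => (u + s • v) k) (v k) 0 := fun k => by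
    simpa using ((hasDerivAt_id (0 : ℝ)).smul_const (v k)).const_add (u k)
  rw [← ((contDiff_polygonMap ℓ).differentiable (by simp) u).lineDeriv_eq_fderiv]
  refine HasLineDerivAt.lineDeriv (HasDerivAt.prodMk (hasDerivAt_pi.2 fun k => ?_)
    (HasDerivAt.fun_sum fun k _ => (hline k).fun_const_smul _))
  simpa using (hline k).norm_sq.sub_const 1

variable {n : ℕ} {ℓ : Fin n → ℝ} {u : Fin n → E}

theorem eq_zero_of_sum_smul_sub_inner_smul_eq_zero (hu : ∀ k, ‖u k‖ = 1) (hpos : ∀ k, 0 < ℓ k)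
    (hgen : IsGenericLength ℓ) (hsum : ∑ k, ℓ k • u k = 0) {z : E}
    (hz : ∑ k, ℓ k • (z - ⟪u k, z⟫ • u k) = 0) : z = 0 := by
  refine congrArg Prod.snd ((isConformalCenter_one_zero_iff.2 hsum).eq_zero_of_sum_add_eq_zero
    (Z := (0, z)) hu hpos hgen ?_)
  have hinner : ∑ k, ℓ k * ⟪u k, z⟫ = 0 := by
    simpa only [sum_inner, real_inner_smul_left, inner_zero_left] using congrArg (⟪·, z⟫) hsum
  have hform : ∀ k, ℓ k * lorentzForm (0, z) (lightVector (u k)) /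
      lorentzForm (1, 0) (lightVector (u k)) ^ 2 = -(ℓ k * ⟪u k, z⟫) := fun k => by
    simp [lorentzForm_lightVector, real_inner_comm]
  simp only [hform]
  refine Prod.ext ?_ ?_
  · simpa [lightVector, Prod.fst_sum] using hinner
  · simp only [smul_sub, Finset.sum_sub_distrib, smul_smul, ← Finset.sum_smul] at hz
    simpa [lightVector, Prod.snd_sum, neg_add_eq_sub] using hz

theorem surjective_fderiv_polygonMap [FiniteDimensional ℝ E] (hpos : ∀ k, 0 < ℓ k)
    (hgen : IsGenericLength ℓ) (hu : polygonMap ℓ u = 0) :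
    Function.Surjective (fderiv ℝ (polygonMap ℓ) u) := by
  obtain ⟨hu1, hsum⟩ := polygonMap_eq_zero_iff.1 hu
  let A : E →ₗ[ℝ] E := ∑ k, ℓ k • (LinearMap.id - (innerₛₗ ℝ (u k)).smulRight (u k))
  have hA : ∀ z, A z = ∑ k, ℓ k • (z - ⟪u k, z⟫ • u k) := fun z => by
    simp [A, LinearMap.sum_apply]
  have hinj : Function.Injective A := (injective_iff_map_eq_zero A).2 fun z hz =>
    eq_zero_of_sum_smul_sub_inner_smul_eq_zero hu1 hpos hgen hsum ((hA z).symm.trans hz)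
  rintro ⟨a, w⟩
  obtain ⟨z, hz⟩ := LinearMap.injective_iff_surjective.1 hinj (w - ∑ k, ℓ k • (a k / 2) • u k)
  refine ⟨fun k => (a k / 2) • u k + (z - ⟪u k, z⟫ • u k), ?_⟩
  rw [fderiv_polygonMap]
  refine Prod.ext (funext fun k => ?_) ?_
  · simp only [inner_add_right, inner_sub_right, real_inner_smul_right,
      real_inner_self_eq_norm_sq, hu1]
    ring
  · simp only [smul_add _ (_ • _ : E), Finset.sum_add_distrib]
    rw [← hA, hz, add_sub_cancel]

end PolygonMap

section PolygonSpaces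

open Module

variable {d n : ℕ} {ℓ ℓ' : Fin n → ℝ} {u : Fin n → EuclideanSpace ℝ (Fin d)}

theorem mem_polygonSpace_iff :
    u ∈ polygonSpace d ℓ ↔ (∀ k, ‖u k‖ = 1) ∧ ∑ k, ℓ k • u k = 0 := by
  simp [polygonSpace]

theorem polygonSpace_eq_preimage : polygonSpace d ℓ = polygonMap ℓ ⁻¹' {0} :=
  Set.ext fun _ => mem_polygonSpace_iff.trans polygonMap_eq_zero_iff.symm

theorem mul_eq_polygonDim_add_add (h : n + d ≤ n * d) : n * d = polygonDim d n + (n + d) := by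
  rcases n with _ | a
  · simp_all [polygonDim]
  rcases d with _ | b
  · simp at h
  have hmul : (a + 1) * (b + 1) = a * b + a + b + 1 := by ring
  rw [hmul] at h ⊢
  simp only [polygonDim, Nat.add_sub_cancel]
  lia

theorem exists_isEmbeddedSubmanifold_polygonSpace (d : ℕ) (hpos : ∀ k, 0 < ℓ k)
    (hgen : IsGenericLength ℓ) :
    ∃ _ : ChartedSpace (EuclideanSpace ℝ (Fin (polygonDim d n))) (polygonSpace d ℓ),
      IsEmbeddedSubmanifold (polygonDim d n) (polygonSpace d ℓ) := by
  rcases (polygonSpace d ℓ).eq_empty_or_nonempty with hempty | ⟨p, hp⟩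
  · rw [hempty]
    exact exists_isEmbeddedSubmanifold_empty _ _
  rw [polygonSpace_eq_preimage] at hp ⊢
  have hsurj : ∀ q : Fin n → EuclideanSpace ℝ (Fin d), polygonMap ℓ q = 0 →
      Function.Surjective (fderiv ℝ (polygonMap ℓ) q) := fun q =>
    surjective_fderiv_polygonMap hpos hgen
  refine exists_isEmbeddedSubmanifold_preimage_zero (contDiff_polygonMap ℓ) hsurj ?_
  have hV : finrank ℝ (Fin n → EuclideanSpace ℝ (Fin d)) = n * d := by
    simp [finrank_pi_fintype]
  have hW : finrank ℝ ((Fin n → ℝ) × EuclideanSpace ℝ (Fin d)) = n + d := by simp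
  have hle := LinearMap.finrank_le_finrank_of_surjective
    (f := (fderiv ℝ (polygonMap ℓ) p).toLinearMap) (hsurj p hp)
  rw [hV, hW] at hle ⊢
  exact mul_eq_polygonDim_add_add hle

theorem SameChamber.symm (hchamber : SameChamber ℓ ℓ') : SameChamber ℓ' ℓ :=
  fun J => (hchamber J).symm

theorem SameChamber.exists_isConformalCenter (hchamber : SameChamber ℓ ℓ')
    (hpos : ∀ k, 0 < ℓ k) (hpos' : ∀ k, 0 < ℓ' k) (hgen' : IsGenericLength ℓ')
    (hu : u ∈ polygonSpace d ℓ) : ∃ X, IsConformalCenter ℓ' u X :=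
  have ⟨hu1, hsum⟩ := mem_polygonSpace_iff.1 hu
  (hchamber.isStableConfiguration (fun k => (hpos k).le) hgen' hu1 hsum).exists_isConformalCenter
    (fun k => (hpos' k).le) hu1

theorem SameChamber.balancedPolygon_mem_polygonSpace (hchamber : SameChamber ℓ ℓ')
    (hpos : ∀ k, 0 < ℓ k) (hpos' : ∀ k, 0 < ℓ' k) (hgen' : IsGenericLength ℓ')
    (hu : u ∈ polygonSpace d ℓ) : balancedPolygon ℓ' u ∈ polygonSpace d ℓ' :=
  have hu1 := (mem_polygonSpace_iff.1 hu).1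
  have hℓ' := (hgen'.sum_pos hpos').ne'
  have hX := hchamber.exists_isConformalCenter hpos hpos' hgen' hu
  mem_polygonSpace_iff.2
    ⟨norm_balancedPolygon hu1 hℓ' hX, sum_smul_balancedPolygon hu1 hℓ' hX⟩

theorem SameChamber.contDiffOn_balancedPolygon (d : ℕ) (hchamber : SameChamber ℓ ℓ')
    (hpos : ∀ k, 0 < ℓ k) (hpos' : ∀ k, 0 < ℓ' k) (hgen' : IsGenericLength ℓ') :
    ContDiffOn ℝ ∞ (balancedPolygon ℓ') (polygonSpace d ℓ) :=
  (_root_.contDiffOn_balancedPolygon hpos' hgen').mono fun _ hu =>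
    ⟨(mem_polygonSpace_iff.1 hu).1, hchamber.exists_isConformalCenter hpos hpos' hgen' hu⟩

theorem SameChamber.balancedPolygon_balancedPolygon (hchamber : SameChamber ℓ ℓ')
    (hpos : ∀ k, 0 < ℓ k) (hpos' : ∀ k, 0 < ℓ' k) (hgen : IsGenericLength ℓ)
    (hgen' : IsGenericLength ℓ') (hu : u ∈ polygonSpace d ℓ) :
    balancedPolygon ℓ (balancedPolygon ℓ' u) = u :=
  have ⟨hu1, hsum⟩ := mem_polygonSpace_iff.1 hu
  _root_.balancedPolygon_balancedPolygon hpos hgen hu1 (hgen'.sum_pos hpos').ne'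
    (hchamber.exists_isConformalCenter hpos hpos' hgen' hu) hsum

/-- Balancing, as a bijection between the polygon spaces of two length vectors in the same
chamber; the inverse balances with respect to the original lengths. -/
noncomputable def SameChamber.polygonEquiv (d : ℕ) (hchamber : SameChamber ℓ ℓ')
    (hpos : ∀ k, 0 < ℓ k) (hpos' : ∀ k, 0 < ℓ' k) (hgen : IsGenericLength ℓ)
    (hgen' : IsGenericLength ℓ') : polygonSpace d ℓ ≃ polygonSpace d ℓ' where
  toFun u := ⟨balancedPolygon ℓ' u.1,
    hchamber.balancedPolygon_mem_polygonSpace hpos hpos' hgen' u.2⟩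
  invFun u := ⟨balancedPolygon ℓ u.1,
    hchamber.symm.balancedPolygon_mem_polygonSpace hpos' hpos hgen u.2⟩
  left_inv u := Subtype.ext <|
    hchamber.balancedPolygon_balancedPolygon hpos hpos' hgen hgen' u.2
  right_inv u := Subtype.ext <|
    hchamber.symm.balancedPolygon_balancedPolygon hpos' hpos hgen' hgen u.2

theorem SameChamber.polygonEquiv_smul (hchamber : SameChamber ℓ ℓ')
    (hpos : ∀ k, 0 < ℓ k) (hpos' : ∀ k, 0 < ℓ' k) (hgen : IsGenericLength ℓ)
    (hgen' : IsGenericLength ℓ') (g : Matrix.orthogonalGroup (Fin d) ℝ) (u : polygonSpace d ℓ) :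
    hchamber.polygonEquiv d hpos hpos' hgen hgen' (g • u) =
      g • hchamber.polygonEquiv d hpos hpos' hgen hgen' u :=
  Subtype.ext <| funext <| balancedPolygon_map hpos' hgen' (mem_polygonSpace_iff.1 u.2).1
    (hchamber.exists_isConformalCenter hpos hpos' hgen' u.2)
    ⟨Matrix.toEuclideanLin g.1, norm_toEuclideanLin_orthogonal g⟩

end PolygonSpaces

theorem mainTheorem9 (d n : ℕ) (hd : 2 ≤ d) (ℓ ℓ' : Fin n → ℝ)
    (hpos : ∀ k, 0 < ℓ k) (hpos' : ∀ k, 0 < ℓ' k)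
    (hgen : IsGenericLength ℓ) (hgen' : IsGenericLength ℓ')
    (hchamber : SameChamber ℓ ℓ') :
    (∃ _ : ChartedSpace (EuclideanSpace ℝ (Fin (polygonDim d n))) (polygonSpace d ℓ),
      IsEmbeddedSubmanifold (polygonDim d n) (polygonSpace d ℓ)) ∧
    (∃ _ : ChartedSpace (EuclideanSpace ℝ (Fin (polygonDim d n))) (polygonSpace d ℓ'),
      IsEmbeddedSubmanifold (polygonDim d n) (polygonSpace d ℓ')) ∧
    ∀ [ChartedSpace (EuclideanSpace ℝ (Fin (polygonDim d n))) (polygonSpace d ℓ)]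
      [ChartedSpace (EuclideanSpace ℝ (Fin (polygonDim d n))) (polygonSpace d ℓ')],
      IsEmbeddedSubmanifold (polygonDim d n) (polygonSpace d ℓ) →
      IsEmbeddedSubmanifold (polygonDim d n) (polygonSpace d ℓ') →
      ∃ Φ : polygonSpace d ℓ ≃ₘ^∞⟮𝓡 (polygonDim d n), 𝓡 (polygonDim d n)⟯ polygonSpace d ℓ',
        ∀ (g : Matrix.orthogonalGroup (Fin d) ℝ) (u : polygonSpace d ℓ),
          Φ (g • u) = g • Φ u := by
  refine ⟨exists_isEmbeddedSubmanifold_polygonSpace d hpos hgen,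
    exists_isEmbeddedSubmanifold_polygonSpace d hpos' hgen', fun hS hS' => ?_⟩
  exact ⟨⟨hchamber.polygonEquiv d hpos hpos' hgen hgen',
    hS.contMDiff_of_contDiffOn hS'
      (hchamber.contDiffOn_balancedPolygon d hpos hpos' hgen') fun _ => rfl,
    hS'.contMDiff_of_contDiffOn hS
      (hchamber.symm.contDiffOn_balancedPolygon d hpos' hpos hgen) fun _ => rfl⟩,
    hchamber.polygonEquiv_smul hpos hpos' hgen hgen'⟩
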